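/- **Setting.** Let $\mathcal L$ be a first-order language with countably many (numbered) symbols and $\mathcal S$ its set of sentences, written as strings over a fixed finite alphabet. Sentences are viewed as propositional combinations of *prime* sentences (equations, relations between closed terms, quantified sentences). A *world* is a map $\mathbb W:\mathcal S\to\{0,1\}$; it is *propositionally consistent* if it respects the propositional connectives, and $\mathcal{PC}(A)$ is the set of propositionally consistent worlds in which all sentences of $A\subseteq\mathcal S$ are true. For $\Gamma\subseteq\mathcal S$, $\Gamma\vdash\varphi$ means that $\varphi$ is derivable from $\Gamma$ and propositional tautologies by modus ponens. Days are indexed by $n\in\mathbb N$. A sequence is *efficiently computable* if a Turing machine outputs its $n$-th term (as a string) on input $n$ in time polynomial in $n$. A *market* is a computable sequence $\overline{\mathbb P}=(\mathbb P_n)_n$ of functions $\mathbb P_n:\mathcal S\to\mathbb Q\cap[0,1]$. A *deductive process* is a computable nested sequence $D_0\subseteq D_1\subseteq\cdots$ of finite subsets of $\mathcal S$; it is *$\Gamma$-complete* if $\mathcal{PC}(\bigcup_n D_n)=\mathcal{PC}(\Gamma)$. An *expressible feature of rank $\le n$* is a function of valuation sequences $\overline{\mathbb V}$ given by an expression built from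 the prices $\mathbb V_i(\varphi)$ ($\varphi\in\mathcal S$, $i\le n$), rational constants, addition, multiplication, $\max$, and $\xi\mapsto 1/\max(1,\xi)$; expressions may use variables that abbreviate previously defined expressions. A *trader* $\overline T$ gives for each $n$ a list $(\varphi_1,\xi_1),\dots,(\varphi_k,\xi_k)$ of sentences and features of rank $\le n$, standing for $T_n=\sum_j\xi_j\cdot(\varphi_j-\mathbb V_n(\varphi_j))$; write $\mathbb W(T_n(\overline{\mathbb V}))=\sum_j\xi_j(\overline{\mathbb V})\,(\mathbb W(\varphi_j)-\mathbb V_n(\varphi_j))$. The trader *exploits* $\overline{\mathbb P}$ relative to $\overline D$ if the set $\{\sum_{i\le n}\mathbb W(T_i(\overline{\mathbb P})) : n\in\mathbb N,\ \mathbb W\in\mathcal{PC}(D_n)\}$ is bounded below but not bounded above. A market $\overline{\mathbb P}$ is a *logical inductor over $\Gamma$* if, for some $\Gamma$-complete deductive process $\overline D$, no efficiently computable trader exploits $\overline{\mathbb P}$ relative to $\overline D$. Let $\Gamma$ be a consistent first-order theory whose axioms include those of first-order logic (so that every logically valid sentence is derivable from $\Gamma$ in the above sense), and suppose that $\Gamma$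 can represent computable functions: each $n\in\mathbb N$ has a numeral in $\Gamma$ (given by a formula that provably defines a unique value), and for each computable $f:\mathbb N\to\mathbb N$ there is a chosen formula $\gamma_f$ such that for all $n,y$: $y=f(n)$ if and only if $\Gamma\vdash\forall\nu\,(\gamma_f(n,\nu)\leftrightarrow\nu=y)$. Rational numbers, sentences and pairs are coded by natural numbers, and "$<$" is a formula that represents the order of the rationals in $\Gamma$ (for rationals $q,r$: if $q<r$ then $\Gamma\vdash q<r$, otherwise $\Gamma\vdash\neg(q<r)$). For a computable function $f$ that computes the market $\overline{\mathbb P}$, i.e. $f(n,\varphi)=\mathbb P_n(\varphi)$ for all $n$ and $\varphi$, the sentence "$\mathbb P_n(\varphi)<p$" is $\forall\nu\,(\gamma_f((n,\varphi),\nu)\to\nu<p)$. **Theorem (Paradox Resistance).** Let $\overline{\mathbb P}$ be a logical inductor over $\Gamma$, let $f$ be a computable function that computes $\overline{\mathbb P}$, let $p\in(0,1)$ be rational, and let $(\chi_n)_n$ be an efficiently computable sequence of sentences such that $$\Gamma\vdash\ \chi_n\leftrightarrow\bigl(\text{"}\mathbb P_n(\chi_n)<p\text{"}\bigr)\qquad\text{for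 all } n .$$ Then $$\lim_{n\to\infty}\mathbb P_n(\chi_n)=p .$$ -/

import Mathlib

namespace LogicalInduction

open FirstOrder FirstOrder.Language

/-! ### Worlds and provability

Sentences are first-order sentences, seen as formulas of a propositional calculus whose atoms are
the prime sentences (equations, relations between closed terms, and quantified sentences). Mathlib
builds sentences from `⊥`, `imp`, prime formulas and `all`; the other connectives abbreviate. -/

/-- A world is any assignment of truth values to the sentences. -/
abbrev World (L : FirstOrder.Language.{0, 0}) := L.Sentence → Bool

/-- Propositionally consistent worlds: the connectives are interpreted as Boolean operations, while
prime sentences may receive any truth value. -/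
structure PropConsistent {L : FirstOrder.Language.{0, 0}} (W : World L) : Prop where
  falsum : W ⊥ = false
  imp : ∀ φ ψ : L.Sentence, W (φ.imp ψ) = (!W φ || W ψ)

/-- The worlds propositionally consistent with the set `A` of sentences. -/
def PC {L : FirstOrder.Language.{0, 0}} (A : Set L.Sentence) : Set (World L) :=
  {W | PropConsistent W ∧ ∀ φ ∈ A, W φ = true}

/-- `Proves Γ φ`: there is a proof of `φ` from `Γ` and propositional tautologies with modus ponens
as the only rule of inference. -/
inductive Proves {L : FirstOrder.Language.{0, 0}} (Γ : Set L.Sentence) : L.Sentence → Prop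
  | ax {φ : L.Sentence} : φ ∈ Γ → Proves Γ φ
  | taut {φ : L.Sentence} : (∀ W : World L, PropConsistent W → W φ = true) → Proves Γ φ
  | mp {φ ψ : L.Sentence} : Proves Γ (φ.imp ψ) → Proves Γ φ → Proves Γ ψ

/-- `Γ` is consistent. -/
def Consistent {L : FirstOrder.Language.{0, 0}} (Γ : Set L.Sentence) : Prop := ¬ Proves Γ ⊥

/-- `Γ` is a first-order theory presented with the axioms of first-order logic included, so that
modus ponens is the only rule needed: all logically valid sentences can be proved from `Γ`. -/
def IncludesFirstOrderLogic {L : FirstOrder.Language.{0, 0}} (Γ : Set L.Sentence) : Prop :=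
  ∀ φ : L.Sentence, (∅ : L.Theory) ⊨ᵇ φ → Proves Γ φ

/-! ### Writing sentences as strings -/

/-- The alphabet in which sentences and trading strategies are written. -/
abbrev Sym := Fin 19

namespace Sym

abbrev bit0 : Sym := 0
abbrev bit1 : Sym := 1
abbrev sep : Sym := 2
abbrev bot : Sym := 3
abbrev eq : Sym := 4
abbrev rel : Sym := 5
abbrev fn : Sym := 6
abbrev var : Sym := 7
abbrev imp : Sym := 8
abbrev all : Sym := 9
abbrev price : Sym := 10
abbrev const : Sym := 11
abbrev ref : Sym := 12
abbrev add : Sym := 13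
abbrev mul : Sym := 14
abbrev max : Sym := 15
abbrev recip : Sym := 16
abbrev define : Sym := 17
abbrev trade : Sym := 18

end Sym

/-- Unary notation; used for arities, indices of variables and days. -/
def unaryString (n : ℕ) : List Sym := List.replicate n Sym.bit1 ++ [Sym.sep]

/-- Binary notation (least significant digit first). -/
def binaryString (n : ℕ) : List Sym :=
  (Nat.bits n).map (fun b => if b then Sym.bit1 else Sym.bit0) ++ [Sym.sep]

/-- Rationals are written as sign, numerator, denominator. -/
def ratString (q : ℚ) : List Sym :=
  (if q < 0 then Sym.bit1 else Sym.bit0) :: (binaryString q.num.natAbs ++ binaryString q.den)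

section Strings

variable {L : FirstOrder.Language.{0, 0}} [∀ n, Encodable (L.Functions n)] [∀ n, Encodable (L.Relations n)]

/-- Terms in Polish notation. -/
def termString {k : ℕ} : L.Term (Empty ⊕ Fin k) → List Sym
  | .var (.inl e) => e.elim
  | .var (.inr i) => Sym.var :: unaryString i
  | .func (l := n) f ts =>
      Sym.fn :: (unaryString n ++ binaryString (Encodable.encode f) ++
        (List.ofFn fun i => termString (ts i)).flatten)

/-- Formulas in Polish notation; a bound variable is written as the number of quantifiers that
enclose the one that binds it. -/
def formulaString : {k : ℕ} → L.BoundedFormula Empty k → List Sym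
  | _, .falsum => [Sym.bot]
  | _, .equal s t => Sym.eq :: (termString s ++ termString t)
  | _, .rel (l := n) R ts =>
      Sym.rel :: (unaryString n ++ binaryString (Encodable.encode R) ++
        (List.ofFn fun i => termString (ts i)).flatten)
  | _, .imp φ ψ => Sym.imp :: (formulaString φ ++ formulaString ψ)
  | _, .all φ => Sym.all :: formulaString φ

/-- The string that a sentence is. -/
def sentenceString (φ : L.Sentence) : List Sym := formulaString φ

/-- The Gödel number of a sentence: the number of its string. -/
def code (φ : L.Sentence) : ℕ := Encodable.encode (sentenceString φ)

end Strings

/-- The number that codes a rational number. -/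
def ratCode (q : ℚ) : ℕ := Nat.pair (Encodable.encode q.num) q.den

/-- A sequence is efficiently computable if some (multi-stack) Turing machine, given `n` in unary,
outputs the string that stands for `x n` within a number of steps polynomial in `n`. -/
def EfficientlyComputable {α : Type} (toString : α → List Sym) (x : ℕ → α) : Prop :=
  Nonempty (Turing.TM2ComputableInPolyTime Computability.unaryEncodeNat toString x)

/-! ### Markets and deductive processes

Days are numbered by the natural numbers. -/

section Markets

variable {L : FirstOrder.Language.{0, 0}} [∀ n, Encodable (L.Functions n)] [∀ n, Encodable (L.Relations n)]

/-- `f` computes the prices `P`: from a day and a sentence (paired into one number) it gives the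
rational number that is the price. -/
def ComputesPrices (f : ℕ → ℕ) (P : ℕ → L.Sentence → ℚ) : Prop :=
  Computable f ∧ ∀ n φ, f (Nat.pair n (code φ)) = ratCode (P n φ)

/-- A market is a computable sequence of pricings `L.Sentence → ℚ ∩ [0,1]`. -/
def IsMarket (P : ℕ → L.Sentence → ℚ) : Prop :=
  (∀ n φ, P n φ ∈ Set.Icc (0 : ℚ) 1) ∧ ∃ f, ComputesPrices f P

/-- A deductive process is a computable nested sequence of finite sets of sentences. -/
def IsDeductiveProcess (D : ℕ → Finset L.Sentence) : Prop :=
  Monotone D ∧ ∃ g : ℕ → List ℕ, Computable g ∧ ∀ n k, k ∈ g n ↔ ∃ φ ∈ D n, code φ = k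

/-- `D` is `Γ`-complete: in the limit it rules out exactly the worlds inconsistent with `Γ`. -/
def CompleteFor (Γ : Set L.Sentence) (D : ℕ → Finset L.Sentence) : Prop :=
  PC (⋃ n, (D n : Set L.Sentence)) = PC Γ

end Markets

/-! ### Traders -/

/-- Expressions for expressible features: prices of sentences, rational numbers, variables
(standing for expressions defined before), sums, products, maxima, and safe reciprocation
`1 / max 1 ξ`. -/
inductive FeatureExpr (S : Type) : Type
  | price (φ : S) (i : ℕ)
  | const (q : ℚ)
  | ref (j : ℕ)
  | add (ξ ζ : FeatureExpr S)
  | mul (ξ ζ : FeatureExpr S)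
  | max (ξ ζ : FeatureExpr S)
  | recip (ξ : FeatureExpr S)

namespace FeatureExpr

/-- `ξ` involves only prices up to day `n` and the first `v` variables. -/
def WellFormed {S : Type} (n v : ℕ) : FeatureExpr S → Prop
  | price _ i => i ≤ n
  | const _ => True
  | ref j => j < v
  | add ξ ζ => ξ.WellFormed n v ∧ ζ.WellFormed n v
  | mul ξ ζ => ξ.WellFormed n v ∧ ζ.WellFormed n v
  | max ξ ζ => ξ.WellFormed n v ∧ ζ.WellFormed n v
  | recip ξ => ξ.WellFormed n v

/-- The value of `ξ` on the valuation sequence `V`, where `vals` lists the values of the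
variables. -/
noncomputable def eval {S : Type} (V : ℕ → S → ℝ) (vals : List ℝ) : FeatureExpr S → ℝ
  | price φ i => V i φ
  | const q => q
  | ref j => vals.getD j 0
  | add ξ ζ => ξ.eval V vals + ζ.eval V vals
  | mul ξ ζ => ξ.eval V vals * ζ.eval V vals
  | max ξ ζ => Max.max (ξ.eval V vals) (ζ.eval V vals)
  | recip ξ => (Max.max 1 (ξ.eval V vals))⁻¹

/-- Feature expressions in Polish notation, for sentences written by `s`. -/
def toString {S : Type} (s : S → List Sym) : FeatureExpr S → List Sym
  | price φ i => Sym.price :: (unaryString i ++ s φ)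
  | const q => Sym.const :: ratString q
  | ref j => Sym.ref :: unaryString j
  | add ξ ζ => Sym.add :: (ξ.toString s ++ ζ.toString s)
  | mul ξ ζ => Sym.mul :: (ξ.toString s ++ ζ.toString s)
  | max ξ ζ => Sym.max :: (ξ.toString s ++ ζ.toString s)
  | recip ξ => Sym.recip :: ξ.toString s

end FeatureExpr

/-- A trading strategy: definitions `v₀ := ξ₀, v₁ := ξ₁, …` of variables, followed by a list of
trades `(φ, ξ)`, each an order to buy `ξ` shares of `φ` at the prevailing price. -/
structure Strategy (S : Type) where
  defs : List (FeatureExpr S)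
  trades : List (S × FeatureExpr S)

namespace Strategy

/-- `T` is a strategy for day `n`: it uses prices up to day `n` only, and every variable is defined
before it is used. -/
def IsForDay {S : Type} (n : ℕ) (T : Strategy S) : Prop :=
  (∀ (k : ℕ) (h : k < T.defs.length), (T.defs[k]).WellFormed n k) ∧
    ∀ t ∈ T.trades, t.2.WellFormed n T.defs.length

/-- The values of the variables of `T`, in order. -/
noncomputable def vals {S : Type} (T : Strategy S) (V : ℕ → S → ℝ) : List ℝ :=
  T.defs.foldl (fun l ξ => l ++ [ξ.eval V l]) []

/-- The value according to the truth assignment `W` of the affine combination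
`∑ i, ξ i * (φ i - (price of φ i on day n))`, the features `ξ i` being evaluated on `V`. -/
noncomputable def value {S : Type} (T : Strategy S) (n : ℕ) (V : ℕ → S → ℝ) (W : S → Bool) : ℝ :=
  (T.trades.map fun t => t.2.eval V (T.vals V) * ((if W t.1 then 1 else 0) - V n t.1)).sum

/-- The string that a strategy is. -/
def toString {S : Type} (s : S → List Sym) (T : Strategy S) : List Sym :=
  (T.defs.map fun ξ => Sym.define :: ξ.toString s).flatten ++
    (T.trades.map fun t => Sym.trade :: (s t.1 ++ t.2.toString s)).flatten

end Strategy

/-- A trader gives a strategy for each day. -/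
def IsTrader {S : Type} (T : ℕ → Strategy S) : Prop := ∀ n, (T n).IsForDay n

/-- The plausible assessments of the net worth of the trader `T` on the valuation sequence `V`. -/
def plausibleWorths {L : FirstOrder.Language.{0, 0}} (T : ℕ → Strategy L.Sentence) (V : ℕ → L.Sentence → ℝ)
    (D : ℕ → Finset L.Sentence) : Set ℝ :=
  {x | ∃ n, ∃ W ∈ PC (D n : Set L.Sentence), x = ∑ i ∈ Finset.range (n + 1), (T i).value i V W}

/-- The trader `T` exploits the valuation sequence `V` relative to the deductive process `D`. -/
def Exploits {L : FirstOrder.Language.{0, 0}} (T : ℕ → Strategy L.Sentence) (V : ℕ → L.Sentence → ℝ)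
    (D : ℕ → Finset L.Sentence) : Prop :=
  BddBelow (plausibleWorths T V D) ∧ ¬ BddAbove (plausibleWorths T V D)

section Inductors

variable {L : FirstOrder.Language.{0, 0}} [∀ n, Encodable (L.Functions n)] [∀ n, Encodable (L.Relations n)]

/-- The logical induction criterion relative to `D`: no efficiently computable trader exploits
`P`. -/
def LogicalInductionCriterion (P : ℕ → L.Sentence → ℚ) (D : ℕ → Finset L.Sentence) : Prop :=
  ∀ T : ℕ → Strategy L.Sentence, IsTrader T →
    EfficientlyComputable (Strategy.toString sentenceString) T →
      ¬ Exploits T (fun n φ => (P n φ : ℝ)) D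

/-- `P` is a logical inductor over `Γ`. -/
def IsLogicalInductor (Γ : Set L.Sentence) (P : ℕ → L.Sentence → ℚ) : Prop :=
  IsMarket P ∧ ∃ D : ℕ → Finset L.Sentence,
    IsDeductiveProcess D ∧ CompleteFor Γ D ∧ LogicalInductionCriterion P D

end Inductors

/-! ### Representing computations in a theory -/

section Representing

variable {L : FirstOrder.Language.{0, 0}}

/-- The universal closure of a formula in `k` variables. -/
def univClosure {k : ℕ} (φ : L.Formula (Fin k)) : L.Sentence :=
  BoundedFormula.alls (BoundedFormula.relabel (β := Empty) (Sum.inr : Fin k → Empty ⊕ Fin k) φ)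

/-- `num n` is a formula, free in one variable, that stands for the number `n`, and `Γ` proves that
it defines a unique value. In arithmetic `num n` is the equation `x = 1 + ⋯ + 1`; in set theory it
defines the `n`-th finite ordinal. A statement about the numbers `n₁, …, n_k` abbreviates
`∀ x₁ … x_k, num n₁ x₁ → ⋯ → num n_k x_k → …`. -/
def AreNumerals (Γ : Set L.Sentence) (num : ℕ → L.Formula (Fin 1)) : Prop :=
  ∀ n, Proves Γ (BoundedFormula.not (univClosure (num n).not)) ∧
    Proves Γ (univClosure (((num n).relabel ![(0 : Fin 2)]).imp
      (((num n).relabel ![(1 : Fin 2)]).imp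
        (Term.equal (Term.var (0 : Fin 2)) (Term.var (1 : Fin 2))))))

/-- The sentence `∀ ν, γ(n, ν) ↔ ν = y`. -/
def valueSentence (num : ℕ → L.Formula (Fin 1)) (γ : L.Formula (Fin 2)) (n y : ℕ) : L.Sentence :=
  univClosure (((num n).relabel ![(0 : Fin 2)]).imp (γ.iff ((num y).relabel ![(1 : Fin 2)])))

/-- The formula `γ` represents the function `f` in `Γ`. -/
def Represents (Γ : Set L.Sentence) (num : ℕ → L.Formula (Fin 1)) (γ : L.Formula (Fin 2))
    (f : ℕ → ℕ) : Prop :=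
  ∀ n y, y = f n ↔ Proves Γ (valueSentence num γ n y)

/-- The formula `lt` represents the order of the rational numbers in `Γ`. -/
def RepresentsRatLt (Γ : Set L.Sentence) (num : ℕ → L.Formula (Fin 1)) (lt : L.Formula (Fin 2)) :
    Prop :=
  ∀ q r : ℚ,
    (q < r → Proves Γ (univClosure (((num (ratCode q)).relabel ![(0 : Fin 2)]).imp
      (((num (ratCode r)).relabel ![(1 : Fin 2)]).imp lt)))) ∧
    (¬ q < r → Proves Γ (univClosure (((num (ratCode q)).relabel ![(0 : Fin 2)]).imp
      (((num (ratCode r)).relabel ![(1 : Fin 2)]).imp lt.not))))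

/-- The sentence `f(m) < p`, that is `∀ x y ν, x = m → y = p → γ(x, ν) → ν < y`, where `γ` is the
formula for `f`. -/
def valueLtSentence (num : ℕ → L.Formula (Fin 1)) (γ lt : L.Formula (Fin 2)) (m : ℕ) (p : ℚ) :
    L.Sentence :=
  univClosure (((num m).relabel ![(0 : Fin 3)]).imp
    (((num (ratCode p)).relabel ![(1 : Fin 3)]).imp
      ((γ.relabel ![(0 : Fin 3), 2]).imp (lt.relabel ![(2 : Fin 3), 1]))))

end Representing

end LogicalInduction

open FirstOrder LogicalInduction

/-! ### Fragments of stack machine programs -/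

/-! Every world consistent with `Γ` makes `χ n` true if its price on day `n` is below `p`, and false
otherwise. By compactness the deductive process settles this after finitely many days
(`exists_PC_settled`). A price that is infinitely often bounded away from `p` is therefore a
recurring mispricing, from which a trader can profit.

Suppose that the price is at most `q - δ` infinitely often, where `q < p`. The trader buys `χ n` on
day `n` when it costs less than `q` and sells it on later days when it costs more than `p`; each
share that completes this cycle earns at least `p - q`. The sentences bought are settled as true, so
their prices eventually exceed any `c < 1`: otherwise a trader who keeps buying one such sentence
while it is cheap would exploit the market (`eventually_le_price_of_settled`). Hence whatever is
bought is sold in the long run, and the capital can be used again. Holdings never exceed one share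
in total, so the worth is at least `-1` in every world (`worth_ge`). The total amount bought is
infinite: otherwise the holdings would eventually be at most `1 / 2`, and each cheap day would force
a purchase of at least `δ / 2` (`not_bddAbove_sum`). The upper bound on the price is the same
argument for a short share with one unit of cash and the threshold `1 - p`; `Position` covers both
cases.

Features are continuous in the prices, so thresholds are softened to hinges: at price `u` the trader
invests the fraction `max 0 (q - u)` of its free capital, and sells the fraction `max 0 (u - p)` of
a holding.

The other half of the work is efficient computability. Past purchases enter a strategy as variables,
which keeps its text polynomial in size. The text is written by a program of a small language with
counting loops and calls to the machine for `χ`; such programs compile to stack machines that run in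
polynomial time (`computes_compile`, `efficientlyComputable_of_prog`, `out_recyclingProg`). -/

namespace StackMachine

open Turing

section General

variable {K : Type} [DecidableEq K] {Γ : K → Type} {σ Λ Λ' : Type}

/-- `Runs m n c c'`: the program `m` leads from `c` to `c'` in `n` steps. -/
inductive Runs (m : Λ → TM2.Stmt Γ Λ σ) : ℕ → TM2.Cfg Γ Λ σ → TM2.Cfg Γ Λ σ → Prop
  | refl (c) : Runs m 0 c c
  | head {n l v S c} : Runs m n (TM2.stepAux (m l) v S) c → Runs m (n + 1) ⟨some l, v, S⟩ c

theorem Runs.trans {m : Λ → TM2.Stmt Γ Λ σ} {n₁ n₂ : ℕ} {c₁ c₂ c₃ : TM2.Cfg Γ Λ σ}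
    (h₁ : Runs m n₁ c₁ c₂) (h₂ : Runs m n₂ c₂ c₃) : Runs m (n₁ + n₂) c₁ c₃ := by
  induction h₁ with
  | refl => simpa using h₂
  | head _ ih => rw [Nat.add_right_comm]; exact .head (ih h₂)

theorem iterate_none (m : Λ → TM2.Stmt Γ Λ σ) (n : ℕ) :
    (flip bind (TM2.step m))^[n] none = none := by
  induction n with
  | zero => rfl
  | succ n ih => rw [Function.iterate_succ_apply]; exact ih

theorem runs_iff_iterate (m : Λ → TM2.Stmt Γ Λ σ) (n : ℕ) (c c' : TM2.Cfg Γ Λ σ) :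
    Runs m n c c' ↔ (flip bind (TM2.step m))^[n] (some c) = some c' := by
  constructor
  · intro h
    induction h with
    | refl => rfl
    | head _ ih => rw [Function.iterate_succ_apply]; exact ih
  · intro h
    induction n generalizing c with
    | zero =>
      obtain rfl : c = c' := by simpa using h
      exact .refl c
    | succ n ih =>
      rw [Function.iterate_succ_apply] at h
      obtain ⟨l, v, S⟩ := c
      cases l with
      | none =>
        have : flip bind (TM2.step m) (some ⟨none, v, S⟩) = none := rfl
        rw [this, iterate_none] at h
        cases h
      | some l => exact .head (ih _ h)

/-- Renames the labels of a statement, replacing `halt` by a jump to `exit` if there is one. -/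
def mapStmt (r : Λ → Λ') (exit : Option Λ') : TM2.Stmt Γ Λ σ → TM2.Stmt Γ Λ' σ
  | .push k f q => .push k f (mapStmt r exit q)
  | .peek k f q => .peek k f (mapStmt r exit q)
  | .pop k f q => .pop k f (mapStmt r exit q)
  | .load f q => .load f (mapStmt r exit q)
  | .branch f q₁ q₂ => .branch f (mapStmt r exit q₁) (mapStmt r exit q₂)
  | .goto l => .goto fun v => r (l v)
  | .halt => exit.elim .halt fun l => .goto fun _ => l

/-- The configuration that corresponds to `c` after `mapStmt`. -/
def mapCfg (r : Λ → Λ') (exit : Option Λ') (c : TM2.Cfg Γ Λ σ) : TM2.Cfg Γ Λ' σ :=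
  ⟨c.l.elim exit fun l => some (r l), c.var, c.stk⟩

theorem stepAux_mapStmt (r : Λ → Λ') (exit : Option Λ') (q : TM2.Stmt Γ Λ σ) (v : σ)
    (S : ∀ k, List (Γ k)) :
    TM2.stepAux (mapStmt r exit q) v S = mapCfg r exit (TM2.stepAux q v S) := by
  induction q generalizing v S with
  | branch f q₁ q₂ ih₁ ih₂ => simp only [mapStmt, TM2.stepAux]; cases f v <;> simp [ih₁, ih₂]
  | halt => cases exit <;> simp [mapStmt, mapCfg]
  | goto => simp [mapStmt, mapCfg]
  | _ => simp_all [mapStmt]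

/-- A halted configuration is sent to one at `exit`, so the run of an embedded fragment ends exactly
where the next one begins. -/
theorem Runs.map {m : Λ → TM2.Stmt Γ Λ σ} {m' : Λ' → TM2.Stmt Γ Λ' σ} {r : Λ → Λ'}
    {exit : Option Λ'} (hm : ∀ l, m' (r l) = mapStmt r exit (m l)) {n : ℕ}
    {c c' : TM2.Cfg Γ Λ σ} (h : Runs m n c c') :
    Runs m' n (mapCfg r exit c) (mapCfg r exit c') := by
  induction h with
  | refl => exact .refl _
  | head _ ih =>
    refine .head ?_
    rwa [hm, stepAux_mapStmt]

variable (Γ σ) in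
/-- A piece of program that ends by halting. -/
structure Fragment where
  Λ : Type
  [fin : Fintype Λ]
  entry : Λ
  code : Λ → TM2.Stmt Γ Λ σ

attribute [instance] Fragment.fin

/-- Started in the state `v` with the stacks `S`, the fragment halts within `t` steps in the same
state with the stacks `S'`. -/
def Fragment.Computes (F : Fragment Γ σ) (v : σ) (t : ℕ) (S S' : ∀ k, List (Γ k)) : Prop :=
  ∃ n ≤ t, Runs F.code n ⟨some F.entry, v, S⟩ ⟨none, v, S'⟩

theorem Fragment.Computes.mono {F : Fragment Γ σ} {v : σ} {t t' : ℕ} {S S' : ∀ k, List (Γ k)}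
    (h : F.Computes v t S S') (ht : t ≤ t') : F.Computes v t' S S' :=
  let ⟨n, hn, hr⟩ := h
  ⟨n, hn.trans ht, hr⟩

theorem Fragment.Computes.congr_right {F : Fragment Γ σ} {v : σ} {t : ℕ}
    {S S' S'' : ∀ k, List (Γ k)} (h : F.Computes v t S S') (hS : S' = S'') :
    F.Computes v t S S'' := hS ▸ h

/-- Execution of one statement. -/
def Fragment.basic (q : TM2.Stmt Γ Unit σ) : Fragment Γ σ := ⟨Unit, (), fun _ => q⟩

theorem Fragment.computes_basic {q : TM2.Stmt Γ Unit σ} {v : σ} {S S' : ∀ k, List (Γ k)}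
    (h : TM2.stepAux q v S = ⟨none, v, S'⟩) : (Fragment.basic q).Computes v 1 S S' :=
  ⟨1, le_rfl, .head (by
    change Runs _ 0 (TM2.stepAux q v S) _
    rw [h]; exact .refl _)⟩

/-- One fragment after another. -/
def Fragment.seq (F G : Fragment Γ σ) : Fragment Γ σ where
  Λ := F.Λ ⊕ G.Λ
  entry := .inl F.entry
  code := Sum.elim (fun l => mapStmt .inl (some (.inr G.entry)) (F.code l))
    fun l => mapStmt .inr none (G.code l)

theorem Fragment.Computes.seq {F G : Fragment Γ σ} {v : σ} {t₁ t₂ : ℕ}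
    {S₁ S₂ S₃ : ∀ k, List (Γ k)} (h₁ : F.Computes v t₁ S₁ S₂) (h₂ : G.Computes v t₂ S₂ S₃) :
    (F.seq G).Computes v (t₁ + t₂) S₁ S₃ := by
  obtain ⟨n₁, hn₁, r₁⟩ := h₁
  obtain ⟨n₂, hn₂, r₂⟩ := h₂
  exact ⟨n₁ + n₂, by lia, .trans
    (r₁.map (m' := (F.seq G).code) (r := .inl) (exit := some (.inr G.entry)) fun _ => rfl)
    (r₂.map (m' := (F.seq G).code) (r := .inr) (exit := none) fun _ => rfl)⟩

end General

/-! ### Loops controlled by a stack -/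

section Registers

variable {K : Type} [DecidableEq K] {Γ : K → Type} {ρ τ : Type}

/-- Push symbols that depend on the register `τ`. -/
def pushAll {Λ : Type} (ps : List (Σ k, Option τ → Γ k)) (q : TM2.Stmt Γ Λ (ρ × Option τ)) :
    TM2.Stmt Γ Λ (ρ × Option τ) :=
  ps.foldr (fun p q => .push p.1 (fun v => p.2 v.2) q) q

/-- The effect of `pushAll` on the stacks. -/
def pushed (ps : List (Σ k, Option τ → Γ k)) (o : Option τ) (S : ∀ k, List (Γ k)) :
    ∀ k, List (Γ k) :=
  ps.foldl (fun S p => Function.update S p.1 (p.2 o :: S p.1)) S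

theorem stepAux_pushAll {Λ : Type} (ps : List (Σ k, Option τ → Γ k))
    (q : TM2.Stmt Γ Λ (ρ × Option τ)) (v : ρ × Option τ) (S : ∀ k, List (Γ k)) :
    TM2.stepAux (pushAll ps q) v S = TM2.stepAux q v (pushed ps v.2 S) := by
  induction ps generalizing S with
  | nil => rfl
  | cons p ps ih => exact ih _

/-- Pop the stack `k` until it is empty; for each symbol, push `ps` and execute `F`. -/
def Fragment.loop (k : K) (read : Γ k → τ) (ps : List (Σ k, Option τ → Γ k))
    (F : Fragment Γ (ρ × Option τ)) : Fragment Γ (ρ × Option τ) where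
  Λ := Option F.Λ
  entry := none
  code
    | none => .pop k (fun v o => (v.1, o.map read)) (.branch (fun v => v.2.isSome)
        (pushAll ps (.load (fun v => (v.1, none)) (.goto fun _ => some F.entry))) .halt)
    | some l => mapStmt some (some none) (F.code l)

variable {k : K} {read : Γ k → τ} {ps : List (Σ k, Option τ → Γ k)}
  {F : Fragment Γ (ρ × Option τ)} {v : ρ}

theorem Fragment.loop_nil {S : ∀ k, List (Γ k)} (h : S k = []) :
    (Fragment.loop k read ps F).Computes (v, none) 1 S S := by
  refine ⟨1, le_rfl, .head ?_⟩
  have : TM2.stepAux ((Fragment.loop k read ps F).code none) (v, none) S = ⟨none, (v, none), S⟩ := by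
    simp [Fragment.loop, h]
  change Runs _ 0 (TM2.stepAux ((Fragment.loop k read ps F).code none) (v, none) S) _
  rw [this]; exact .refl _

/-- The register is cleared before the body starts, so the body sees the same state as the loop;
nested loops can share one register. -/
theorem Fragment.loop_cons {S S₁ S₂ : ∀ k, List (Γ k)} {s : Γ k} {l : List (Γ k)} {t₁ t₂ : ℕ}
    (h : S k = s :: l)
    (h₁ : F.Computes (v, none) t₁ (pushed ps (some (read s)) (Function.update S k l)) S₁)
    (h₂ : (Fragment.loop k read ps F).Computes (v, none) t₂ S₁ S₂) :
    (Fragment.loop k read ps F).Computes (v, none) (1 + t₁ + t₂) S S₂ := by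
  obtain ⟨n₁, hn₁, r₁⟩ := h₁
  obtain ⟨n₂, hn₂, r₂⟩ := h₂
  have r₁' := r₁.map (m' := (Fragment.loop k read ps F).code) (r := some) (exit := some none)
    fun _ => rfl
  refine ⟨n₁ + n₂ + 1, by lia, .head ?_⟩
  have : TM2.stepAux ((Fragment.loop k read ps F).code none) (v, none) S =
      mapCfg some (some none)
        ⟨some F.entry, (v, none), pushed ps (some (read s)) (Function.update S k l)⟩ := by
    simp [Fragment.loop, h, stepAux_pushAll, mapCfg]
  change Runs _ _ (TM2.stepAux ((Fragment.loop k read ps F).code none) (v, none) S) _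
  rw [this]
  exact r₁'.trans r₂

/-- The fragment that does nothing. -/
def Fragment.skip : Fragment Γ (ρ × Option τ) := .basic .halt

theorem Fragment.computes_skip (S : ∀ k, List (Γ k)) :
    (Fragment.skip : Fragment Γ (ρ × Option τ)).Computes (v, none) 1 S S :=
  Fragment.computes_basic rfl

end Registers

end StackMachine

namespace StackMachine

open Turing LogicalInduction

/-! ### Calling a machine as a subroutine -/

/-- The registers added to a machine: an accumulator for the output, an auxiliary stack, and four
counters in unary notation. -/
abbrev Reg := Option (Option (Fin 4))

namespace Reg

abbrev acc : Reg := none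
abbrev tmp : Reg := some none
abbrev ctr (j : Fin 4) : Reg := some (some j)

end Reg

/-- The stack alphabets of a machine extended by the registers. -/
abbrev ExtAlphabet (M : FinTM2) : M.K ⊕ Reg → Type
  | .inl k => M.Γ k
  | .inr _ => Sym

/-- The internal states of the extended machine. -/
abbrev ExtState (M : FinTM2) : Type := M.σ × Option Sym

section Call

variable {M : FinTM2}

/-- The stacks of the extended machine. -/
def join (A : ∀ k, List (M.Γ k)) (B : Reg → List Sym) : ∀ k, List (ExtAlphabet M k)
  | .inl k => A k
  | .inr r => B r

@[simp] theorem join_inl (A : ∀ k, List (M.Γ k)) (B : Reg → List Sym) (k : M.K) :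
    join A B (.inl k) = A k := rfl

@[simp] theorem join_inr (A : ∀ k, List (M.Γ k)) (B : Reg → List Sym) (r : Reg) :
    join A B (.inr r) = B r := rfl

@[simp] theorem update_join_inl (A : ∀ k, List (M.Γ k)) (B : Reg → List Sym) (k : M.K)
    (l : List (M.Γ k)) :
    Function.update (join A B) (.inl k) l = join (Function.update A k l) B := by
  funext x
  rcases x with x | x
  · by_cases h : x = k
    · subst h; simp
    · simp [h]
  · simp

@[simp] theorem update_join_inr (A : ∀ k, List (M.Γ k)) (B : Reg → List Sym) (r : Reg)
    (l : List Sym) :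
    Function.update (join A B) (.inr r) l = join A (Function.update B r l) := by
  funext x
  rcases x with x | x
  · simp
  · by_cases h : x = r
    · subst h; simp
    · simp [h]

/-- A statement of the machine as a statement of the extended machine. -/
def liftStmt : TM2.Stmt M.Γ M.Λ M.σ → TM2.Stmt (ExtAlphabet M) M.Λ (ExtState M)
  | .push k f q => .push (.inl k) (fun v => f v.1) (liftStmt q)
  | .peek k f q => .peek (.inl k) (fun v o => (f v.1 o, v.2)) (liftStmt q)
  | .pop k f q => .pop (.inl k) (fun v o => (f v.1 o, v.2)) (liftStmt q)
  | .load f q => .load (fun v => (f v.1, v.2)) (liftStmt q)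
  | .branch f q₁ q₂ => .branch (fun v => f v.1) (liftStmt q₁) (liftStmt q₂)
  | .goto l => .goto fun v => l v.1
  | .halt => .halt

/-- A configuration of the machine as one of the extended machine. -/
def liftCfg (B : Reg → List Sym) (c : TM2.Cfg M.Γ M.Λ M.σ) :
    TM2.Cfg (ExtAlphabet M) M.Λ (ExtState M) :=
  ⟨c.l, (c.var, none), join c.stk B⟩

theorem stepAux_liftStmt (B : Reg → List Sym) (q : TM2.Stmt M.Γ M.Λ M.σ) (v : M.σ)
    (S : ∀ k, List (M.Γ k)) :
    TM2.stepAux (liftStmt q) (v, none) (join S B) = liftCfg B (TM2.stepAux q v S) := by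
  induction q generalizing v S with
  | branch f q₁ q₂ ih₁ ih₂ => simp only [liftStmt, TM2.stepAux]; cases f v <;> simp [ih₁, ih₂]
  | halt => simp [liftStmt, liftCfg]
  | goto => simp [liftStmt, liftCfg]
  | _ => simp_all [liftStmt]

theorem Runs.lift (B : Reg → List Sym) {n : ℕ} {c c' : TM2.Cfg M.Γ M.Λ M.σ}
    (h : Runs M.m n c c') :
    Runs (fun l => liftStmt (M.m l)) n (liftCfg B c) (liftCfg B c') := by
  induction h with
  | refl => exact .refl _
  | head _ ih =>
    refine .head ?_
    rwa [stepAux_liftStmt]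

/-- An upper bound for the number of symbols that a statement pushes. -/
def pushCount {K : Type} {Γ : K → Type} {Λ σ : Type} : TM2.Stmt Γ Λ σ → ℕ
  | .push _ _ q => pushCount q + 1
  | .peek _ _ q => pushCount q
  | .pop _ _ q => pushCount q
  | .load _ q => pushCount q
  | .branch _ q₁ q₂ => pushCount q₁ + pushCount q₂
  | .goto _ => 0
  | .halt => 0

theorem length_stk_stepAux {K : Type} [DecidableEq K] {Γ : K → Type} {Λ σ : Type}
    (q : TM2.Stmt Γ Λ σ) (v : σ) (S : ∀ k, List (Γ k)) (k : K) :
    ((TM2.stepAux q v S).stk k).length ≤ (S k).length + pushCount q := by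
  induction q generalizing v S with
  | push k' f q ih =>
    refine (ih _ _).trans ?_
    by_cases h : k = k'
    · subst h; simp [pushCount, Nat.add_assoc, Nat.add_comm]
    · simp [h, pushCount]
  | pop k' f q ih =>
    refine (ih _ _).trans ?_
    by_cases h : k = k'
    · subst h; simp [pushCount]
    · simp [h, pushCount]
  | peek k' f q ih => exact ih _ _
  | load f q ih => exact ih _ _
  | branch f q₁ q₂ ih₁ ih₂ =>
    simp only [TM2.stepAux, pushCount]
    cases f v
    · exact (ih₂ _ _).trans (by lia)
    · exact (ih₁ _ _).trans (by lia)
  | goto => simp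
  | halt => simp

theorem Runs.length_stk {K : Type} [DecidableEq K] {Γ : K → Type} {Λ σ : Type}
    {m : Λ → TM2.Stmt Γ Λ σ} {C : ℕ} (hC : ∀ l, pushCount (m l) ≤ C) {n : ℕ}
    {c c' : TM2.Cfg Γ Λ σ} (h : Runs m n c c') (k : K) :
    (c'.stk k).length ≤ (c.stk k).length + n * C := by
  induction h with
  | refl => simp
  | @head n l v S c' _ ih =>
    have h₁ := length_stk_stepAux (m l) v S k
    have h₂ := hC l
    rw [Nat.add_mul, one_mul]
    lia

theorem stk_initList (M : FinTM2) (s : List (M.Γ M.k₀)) :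
    (initList M s).stk = Function.update (fun _ => []) M.k₀ s := by
  funext k
  by_cases h : k = M.k₀
  · subst h; simp [initList]
  · simp [initList, h]

theorem stk_haltList (M : FinTM2) (s : List (M.Γ M.k₁)) :
    (haltList M s).stk = Function.update (fun _ => []) M.k₁ s := by
  funext k
  by_cases h : k = M.k₁
  · subst h; simp [haltList]
  · simp [haltList, h]

/-- The machine `M` as a fragment. -/
def callFragment (M : FinTM2) : Fragment (ExtAlphabet M) (ExtState M) :=
  haveI := M.ΛFin
  ⟨M.Λ, M.main, fun l => liftStmt (M.m l)⟩

/-- A machine halts in its initial state with all stacks but the output empty, so it can be called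
again once the output has been moved away. -/
theorem computes_callFragment {s : List (M.Γ M.k₀)} {s' : List (M.Γ M.k₁)} {t : ℕ}
    (h : TM2OutputsInTime M s (some s') t) (B : Reg → List Sym) :
    (callFragment M).Computes (M.initialState, none) t
      (join (Function.update (fun _ => []) M.k₀ s) B)
      (join (Function.update (fun _ => []) M.k₁ s') B) := by
  have hr : Runs M.m h.steps (initList M s) (haltList M s') :=
    (runs_iff_iterate _ _ _ _).2 h.evals_in_steps
  refine ⟨h.steps, h.steps_le_m, ?_⟩
  have := hr.lift B
  rw [← stk_initList, ← stk_haltList]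
  exact this

theorem length_update_nil_le {K : Type} [DecidableEq K] {Γ : K → Type} (k k' : K)
    (s : List (Γ k)) : (Function.update (fun x => ([] : List (Γ x))) k s k').length ≤ s.length := by
  by_cases h : k' = k
  · subst h; simp
  · simp [h]

/-- Each step pushes a bounded number of symbols. The bound serves to charge for copying the output
of a call. -/
theorem exists_length_output_le (M : FinTM2) : ∃ C : ℕ, ∀ (s : List (M.Γ M.k₀))
    (s' : List (M.Γ M.k₁)) (t : ℕ), Nonempty (TM2OutputsInTime M s (some s') t) →
      s'.length ≤ s.length + t * C := by
  have := M.ΛFin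
  refine ⟨Finset.univ.sup fun l => pushCount (M.m l), fun s s' t ⟨h⟩ => ?_⟩
  have hr : Runs M.m h.steps (initList M s) (haltList M s') :=
    (runs_iff_iterate _ _ _ _).2 h.evals_in_steps
  have h₁ := hr.length_stk
    (fun l => Finset.le_sup (f := fun l => pushCount (M.m l)) (Finset.mem_univ l)) M.k₁
  rw [stk_initList, stk_haltList, Function.update_self] at h₁
  refine h₁.trans (Nat.add_le_add ?_ (Nat.mul_le_mul_right _ h.steps_le_m))
  exact length_update_nil_le _ _ _

end Call

end StackMachine

namespace StackMachine

open Turing LogicalInduction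

/-! ### Moving the contents of stacks -/

section Drain

variable {K : Type} [DecidableEq K] {Γ : K → Type} {ρ τ : Type}

theorem pushed_update {k : K} (ps : List (Σ k, Option τ → Γ k)) (h : ∀ p ∈ ps, p.1 ≠ k)
    (o : Option τ) (S : ∀ k, List (Γ k)) (l : List (Γ k)) :
    pushed ps o (Function.update S k l) = Function.update (pushed ps o S) k l := by
  induction ps generalizing S with
  | nil => rfl
  | cons p ps ih =>
    have hp := h p (by simp)
    have := ih (fun q hq => h q (by simp [hq])) (Function.update S p.1 (p.2 o :: S p.1))
    rw [Function.update_comm hp] at this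
    simpa [pushed, Function.update_of_ne hp] using this

/-- Moving the content of a stack to other stacks. -/
theorem computes_drain {k : K} {read : Γ k → τ} {ps : List (Σ k, Option τ → Γ k)}
    (h : ∀ p ∈ ps, p.1 ≠ k) (v : ρ) (l : List (Γ k)) (S : ∀ k, List (Γ k)) (hl : S k = l) :
    (Fragment.loop k read ps .skip).Computes (v, none) (2 * l.length + 1) S
      (l.foldl (fun S s => pushed ps (some (read s)) S) (Function.update S k [])) := by
  induction l generalizing S with
  | nil =>
    rw [List.foldl_nil, ← hl, Function.update_eq_self, hl]
    exact Fragment.loop_nil hl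
  | cons s l ih =>
    have h₂ := ih (pushed ps (some (read s)) (Function.update S k l)) (by
      rw [pushed_update ps h, Function.update_self])
    rw [pushed_update ps h, Function.update_idem] at h₂
    rw [List.foldl_cons, pushed_update ps h]
    -- Two steps per symbol: one pops and pushes, the other is the empty body.
    refine (Fragment.loop_cons hl (Fragment.computes_skip _) ?_).mono
      (t := 1 + 1 + (2 * l.length + 1)) (by rw [List.length_cons]; lia)
    rwa [pushed_update ps h]

theorem foldl_pushed_one (a : K) (f : Option τ → Γ a) {α : Type} (g : α → τ) (l : List α)
    (S : ∀ k, List (Γ k)) :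
    l.foldl (fun S s => pushed [⟨a, f⟩] (some (g s)) S) S =
      Function.update S a ((l.map fun s => f (some (g s))).reverse ++ S a) := by
  induction l generalizing S with
  | nil => simp
  | cons s l ih => rw [List.foldl_cons, ih]; simp [pushed]

theorem foldl_pushed_two {a b : K} (hab : a ≠ b) (f : Option τ → Γ a) (f' : Option τ → Γ b)
    {α : Type} (g : α → τ) (l : List α) (S : ∀ k, List (Γ k)) :
    l.foldl (fun S s => pushed [⟨a, f⟩, ⟨b, f'⟩] (some (g s)) S) S =
      Function.update (Function.update S a ((l.map fun s => f (some (g s))).reverse ++ S a)) b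
        ((l.map fun s => f' (some (g s))).reverse ++ S b) := by
  induction l generalizing S with
  | nil => simp
  | cons s l ih =>
    rw [List.foldl_cons, ih]
    simp only [pushed, List.foldl_cons, List.foldl_nil, Function.update_self,
      Function.update_of_ne hab.symm, Function.update_of_ne hab, List.map_cons, List.reverse_cons,
      List.append_assoc, List.singleton_append]
    rw [Function.update_comm hab.symm, Function.update_idem, Function.update_idem]

theorem computes_drain_one {k a : K} (ha : a ≠ k) {read : Γ k → τ} {f : Option τ → Γ a} (v : ρ)
    {S S' : ∀ k, List (Γ k)}
    (hS : S' = Function.update (Function.update S k []) a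
      (((S k).map fun s => f (some (read s))).reverse ++ S a)) {t : ℕ} (ht : 2 * (S k).length + 1 ≤ t) :
    (Fragment.loop k read [⟨a, f⟩] .skip).Computes (v, none) t S S' := by
  have h := computes_drain (ps := [⟨a, f⟩]) (read := read) (by simpa using ha) v _ S rfl
  rw [foldl_pushed_one, Function.update_of_ne ha, ← hS] at h
  exact h.mono ht

theorem computes_drain_two {k a b : K} (ha : a ≠ k) (hb : b ≠ k) (hab : a ≠ b) {read : Γ k → τ}
    {f : Option τ → Γ a} {f' : Option τ → Γ b} (v : ρ)
    {S S' : ∀ k, List (Γ k)}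
    (hS : S' = Function.update (Function.update (Function.update S k []) a
      (((S k).map fun s => f (some (read s))).reverse ++ S a)) b
      (((S k).map fun s => f' (some (read s))).reverse ++ S b)) {t : ℕ} (ht : 2 * (S k).length + 1 ≤ t) :
    (Fragment.loop k read [⟨a, f⟩, ⟨b, f'⟩] .skip).Computes (v, none) t S S' := by
  have h := computes_drain (ps := [⟨a, f⟩, ⟨b, f'⟩]) (read := read) (by simp [ha, hb]) v _ S rfl
  rw [foldl_pushed_two hab, Function.update_of_ne ha, Function.update_of_ne hb, ← hS] at h
  exact h.mono ht

end Drain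

/-! ### Programs that write strings -/

/-- Programs that write a string, given the values of four counters. The string that is written
may contain terms of a given sequence of strings. -/
inductive Prog
  /-- write a given string -/
  | emit (w : List Sym)
  /-- write the value of a counter in unary notation -/
  | ones (j : Fin 4)
  /-- write the term of the sequence whose index is the value of a counter -/
  | term (j : Fin 4)
  /-- one program after another -/
  | seq (a b : Prog)
  /-- count down `j` while counting up `i`, then restore both -/
  | loop (j i : Fin 4) (body : Prog)

namespace Prog

/-- The string that the program writes. -/
def out (s : ℕ → List Sym) : Prog → (Fin 4 → ℕ) → List Sym
  | emit w, _ => w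
  | ones j, e => List.replicate (e j) Sym.bit1
  | term j, e => s (e j)
  | seq a b, e => a.out s e ++ b.out s e
  | loop j i body, e => ((List.range (e j)).map fun t =>
      body.out s (Function.update (Function.update e i t) j (e j - 1 - t))).flatten

/-- The counters that loops count up are initially zero. -/
def Ok : Prog → (Fin 4 → ℕ) → Prop
  | emit _, _ => True
  | ones _, _ => True
  | term _, _ => True
  | seq a b, e => a.Ok e ∧ b.Ok e
  | loop j i body, e => i ≠ j ∧ e i = 0 ∧
      ∀ t < e j, body.Ok (Function.update (Function.update e i t) j (e j - 1 - t))

open Polynomial in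
/-- A bound for the running time in terms of a bound for the counters, `T` being the running time
for the terms of the sequence and `Q` a bound for their lengths. -/
noncomputable def cost (T Q : Polynomial ℕ) : Prog → Polynomial ℕ
  | emit _ => 1
  | ones _ => (2 * X + 1) + (2 * X + 1)
  | term _ => (2 * X + 1) + ((2 * X + 1) + (T + (2 * Q + 1)))
  | seq a b => a.cost T Q + b.cost T Q
  | loop _ _ body => (X * (body.cost T Q + 2) + 1) + (2 * X + 1)

end Prog

/-! ### Compiling programs that write strings, with running times -/

section Compile

variable (A : TM2ComputableAux Bool Sym)

/-- Push the symbol in the register to an additional stack. -/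
abbrev toReg (r : Reg) : Σ k, Option Sym → ExtAlphabet A.tm k := ⟨.inr r, fun o => o.getD Sym.bit1⟩

/-- Push `true` to the input stack. -/
abbrev toInput : Σ k, Option Sym → ExtAlphabet A.tm k :=
  ⟨.inl A.tm.k₀, fun _ => A.inputAlphabet.symm true⟩

/-- Empty an additional stack, pushing its symbols elsewhere. -/
abbrev drain (r : Reg) (ps : List (Σ k, Option Sym → ExtAlphabet A.tm k)) :
    Fragment (ExtAlphabet A.tm) (ExtState A.tm) :=
  .loop (.inr r) (id : Sym → Sym) ps .skip

/-- The program as a fragment of an extension of a machine that computes the sequence. -/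
def compile : Prog → Fragment (ExtAlphabet A.tm) (ExtState A.tm)
  | .emit w => .basic (pushAll (w.map fun s => ⟨.inr Reg.acc, fun _ => s⟩) .halt)
  | .ones j => (drain A (Reg.ctr j) [toReg A Reg.tmp, toReg A Reg.acc]).seq
      (drain A Reg.tmp [toReg A (Reg.ctr j)])
  | .term j => (drain A (Reg.ctr j) [toReg A Reg.tmp, toInput A]).seq
      ((drain A Reg.tmp [toReg A (Reg.ctr j)]).seq
        ((callFragment A.tm).seq
          (.loop (.inl A.tm.k₁) A.outputAlphabet [toReg A Reg.acc] .skip)))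
  | .seq a b => (compile a).seq (compile b)
  | .loop j i body =>
      (Fragment.loop (.inr (Reg.ctr j)) (id : Sym → Sym) []
        ((compile body).seq (.basic (pushAll [⟨.inr (Reg.ctr i), fun _ => Sym.bit1⟩] .halt)))).seq
      (drain A (Reg.ctr i) [toReg A (Reg.ctr j)])

/-- The contents of the additional stacks: the values `e` of the counters and the string `w`
written so far. -/
def mem (e : Fin 4 → ℕ) (w : List Sym) : Reg → List Sym
  | none => w.reverse
  | some none => []
  | some (some j) => List.replicate (e j) Sym.bit1

@[simp] theorem update_mem_ctr (e : Fin 4 → ℕ) (w : List Sym) (j : Fin 4) (n : ℕ) :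
    Function.update (mem e w) (some (some j)) (List.replicate n Sym.bit1) =
      mem (Function.update e j n) w := by
  funext r
  rcases r with _ | _ | i
  · simp [mem]
  · simp [mem]
  · by_cases h : i = j
    · subst h; simp [mem]
    · simp [mem, h]

@[simp] theorem update_mem_ctr_nil (e : Fin 4 → ℕ) (w : List Sym) (j : Fin 4) :
    Function.update (mem e w) (some (some j)) [] = mem (Function.update e j 0) w :=
  update_mem_ctr e w j 0

@[simp] theorem update_mem_acc (e : Fin 4 → ℕ) (w l : List Sym) :
    Function.update (mem e w) none (l.reverse ++ w.reverse) = mem e (w ++ l) := by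
  funext r
  rcases r with _ | _ | i <;> simp [mem]

variable {A}

/-- The stacks when no subroutine is active. -/
abbrev idle (B : Reg → List Sym) : ∀ k, List (ExtAlphabet A.tm k) := join (fun _ => []) B

theorem computes_emit (w : List Sym) (v : A.tm.σ) (e : Fin 4 → ℕ) (w₀ : List Sym) :
    (compile A (.emit w)).Computes (v, none) 1 (idle (mem e w₀)) (idle (mem e (w₀ ++ w))) := by
  refine Fragment.computes_basic ?_
  rw [stepAux_pushAll]
  have : ∀ w₀, pushed (w.map fun s => (⟨.inr Reg.acc, fun _ => s⟩ :
      Σ k, Option Sym → ExtAlphabet A.tm k)) none (idle (mem e w₀)) = idle (mem e (w₀ ++ w)) := by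
    induction w with
    | nil => intro w₀; simp [pushed]
    | cons s w ih =>
      intro w₀
      have h := ih (w₀ ++ [s])
      have h₁ := update_mem_acc e w₀ [s]
      simp only [pushed, List.map_cons, List.foldl_cons, update_join_inr] at h ⊢
      simp only [List.reverse_singleton, List.singleton_append] at h₁
      simpa [mem, h₁] using h
  rw [this]
  rfl

/-- A counter is read by emptying it, so a copy goes to `tmp` and from there back to the counter. -/
theorem computes_ones (j : Fin 4) (v : A.tm.σ) (e : Fin 4 → ℕ) (w₀ : List Sym) :
    (compile A (.ones j)).Computes (v, none) ((2 * e j + 1) + (2 * e j + 1)) (idle (mem e w₀))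
      (idle (mem e (w₀ ++ List.replicate (e j) Sym.bit1))) := by
  set w := w₀ ++ List.replicate (e j) Sym.bit1 with hw
  set B := Function.update (mem (Function.update e j 0) w) (some none)
    (List.replicate (e j) Sym.bit1) with hB
  have h₁ : (drain A (Reg.ctr j) [toReg A Reg.tmp, toReg A Reg.acc]).Computes (v, none)
      (2 * e j + 1) (idle (mem e w₀)) (idle B) := by
    refine computes_drain_two ?_ ?_ ?_ v ?_ ?_
    · simp
    · simp
    · simp
    · simp only [idle, update_join_inr, join_inr]
      refine congrArg (join _) (funext fun r => ?_)
      rcases r with _ | _ | i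
      · simp [hB, hw, mem]
      · simp [hB, mem]
      · by_cases h : i = j
        · subst h; simp [hB, mem]
        · simp [hB, mem, h]
    · simp [idle, mem]
  have h₂ : (drain A Reg.tmp [toReg A (Reg.ctr j)]).Computes (v, none)
      (2 * e j + 1) (idle B) (idle (mem e w)) := by
    refine computes_drain_one ?_ v ?_ ?_
    · simp
    · simp only [idle, update_join_inr, join_inr]
      refine congrArg (join _) (funext fun r => ?_)
      rcases r with _ | _ | i
      · simp [hB, mem]
      · simp [mem]
      · by_cases h : i = j
        · subst h; simp [hB, mem]
        · simp [hB, mem, h]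
    · simp [idle, hB]
  exact h₁.seq h₂

theorem unaryEncodeNat_eq_replicate (n : ℕ) :
    Computability.unaryEncodeNat n = List.replicate n true := by
  induction n with
  | zero => rfl
  | succ n ih => rw [Computability.unaryEncodeNat, ih, List.replicate_succ]

theorem computes_term {s : ℕ → List Sym} {T Q : ℕ} (j : Fin 4) (e : Fin 4 → ℕ)
    (hT : Nonempty (TM2OutputsInTime A.tm
      ((Computability.unaryEncodeNat (e j)).map A.inputAlphabet.invFun)
      (some ((s (e j)).map A.outputAlphabet.invFun)) T))
    (hQ : (s (e j)).length ≤ Q) (w₀ : List Sym) :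
    (compile A (.term j)).Computes (A.tm.initialState, none)
      ((2 * e j + 1) + ((2 * e j + 1) + (T + (2 * Q + 1)))) (idle (mem e w₀))
      (idle (mem e (w₀ ++ s (e j)))) := by
  obtain ⟨hT⟩ := hT
  have hin : (Computability.unaryEncodeNat (e j)).map A.inputAlphabet.invFun =
      List.replicate (e j) (A.inputAlphabet.symm true) := by
    rw [unaryEncodeNat_eq_replicate, List.map_replicate]; rfl
  rw [hin] at hT
  set B := Function.update (mem (Function.update e j 0) w₀) (some none)
    (List.replicate (e j) Sym.bit1) with hB
  set I : ∀ k, List (A.tm.Γ k) := Function.update (fun _ => []) A.tm.k₀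
    (List.replicate (e j) (A.inputAlphabet.symm true)) with hI
  have h₁ : (drain A (Reg.ctr j) [toReg A Reg.tmp, toInput A]).Computes (A.tm.initialState, none)
      (2 * e j + 1) (idle (mem e w₀)) (join I B) := by
    refine computes_drain_two ?_ ?_ ?_ _ ?_ ?_
    · simp
    · simp
    · simp
    · simp only [idle, update_join_inr, update_join_inl, join_inr, join_inl]
      congr 1
      · simp [hI, mem]
      funext r
      rcases r with _ | _ | i
      · simp [hB, mem]
      · simp [hB, mem]
      · by_cases h : i = j
        · subst h; simp [hB, mem]
        · simp [hB, mem, h]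
    · simp [idle, mem]
  have h₂ : (drain A Reg.tmp [toReg A (Reg.ctr j)]).Computes (A.tm.initialState, none)
      (2 * e j + 1) (join I B) (join I (mem e w₀)) := by
    refine computes_drain_one ?_ _ ?_ ?_
    · simp
    · simp only [update_join_inr, join_inr]
      refine congrArg (join _) (funext fun r => ?_)
      rcases r with _ | _ | i
      · simp [hB, mem]
      · simp [mem]
      · by_cases h : i = j
        · subst h; simp [hB, mem]
        · simp [hB, mem, h]
    · simp [hB]
  refine h₁.seq (h₂.seq ((computes_callFragment hT _).seq ?_))
  refine computes_drain_one ?_ _ ?_ ?_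
  · simp
  · simp only [update_join_inr, update_join_inl, join_inr, join_inl, Function.update_idem,
      Function.update_self]
    rw [show Function.update (fun _ => []) A.tm.k₁ [] = fun k => ([] : List (A.tm.Γ k)) from
      Function.update_eq_self (f := fun k => ([] : List (A.tm.Γ k))) A.tm.k₁]
    refine congrArg (join _) (funext fun r => ?_)
    rcases r with _ | _ | i <;> simp [mem, Function.comp_def]
  · simpa using hQ

/-- Both counters of a loop return to their initial values. -/
theorem computes_loop {s : ℕ → List Sym} {C : ℕ} {j i : Fin 4} {body : Prog} (hij : i ≠ j)
    {e : Fin 4 → ℕ} (hi : e i = 0) {v : A.tm.σ}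
    (hbody : ∀ t < e j, ∀ w, (compile A body).Computes (v, none) C
      (idle (mem (Function.update (Function.update e i t) j (e j - 1 - t)) w))
      (idle (mem (Function.update (Function.update e i t) j (e j - 1 - t))
        (w ++ body.out s (Function.update (Function.update e i t) j (e j - 1 - t))))))
    (w : List Sym) :
    (compile A (.loop j i body)).Computes (v, none) ((e j * (C + 2) + 1) + (2 * e j + 1))
      (idle (mem e w)) (idle (mem e (w ++ (Prog.loop j i body).out s e))) := by
  -- After `t` passes the counter `i` holds `t` and `j` holds the remaining `r`. A pass costs the
  -- body and two steps, for the pop and the increment.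
  have key : ∀ r t w, t + r = e j → (Fragment.loop (.inr (Reg.ctr j)) (id : Sym → Sym) []
      ((compile A body).seq
        (.basic (pushAll [⟨.inr (Reg.ctr i), fun _ => Sym.bit1⟩] .halt)))).Computes
      (v, none) (r * (C + 2) + 1)
      (idle (mem (Function.update (Function.update e i t) j r) w))
      (idle (mem (Function.update (Function.update e i (e j)) j 0)
        (w ++ ((List.range' t r).map fun t =>
          body.out s (Function.update (Function.update e i t) j (e j - 1 - t))).flatten))) := by
    intro r
    induction r with
    | zero =>
      intro t w ht
      obtain rfl : t = e j := by simpa using ht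
      simpa using Fragment.loop_nil (by simp [mem])
    | succ r ih =>
      intro t w ht
      have h₁ := hbody t (by lia) w
      rw [show e j - 1 - t = r by lia] at h₁
      have h₃ := ih (t + 1) (w ++ body.out s (Function.update (Function.update e i t) j r)) (by lia)
      rw [List.range'_succ, List.map_cons, List.flatten_cons, ← List.append_assoc,
        show e j - 1 - t = r by lia]
      have h₂ : (Fragment.basic (pushAll [⟨.inr (Reg.ctr i), fun _ => Sym.bit1⟩] .halt) :
          Fragment (ExtAlphabet A.tm) (ExtState A.tm)).Computes (v, none) 1
          (idle (mem (Function.update (Function.update e i t) j r)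
            (w ++ body.out s (Function.update (Function.update e i t) j r))))
          (idle (mem (Function.update (Function.update e i (t + 1)) j r)
            (w ++ body.out s (Function.update (Function.update e i t) j r)))) := by
        refine Fragment.computes_basic ?_
        rw [stepAux_pushAll]
        simp only [pushed, List.foldl_cons, List.foldl_nil, idle, update_join_inr, join_inr]
        have h₃ : Sym.bit1 :: mem (Function.update (Function.update e i t) j r)
            (w ++ body.out s (Function.update (Function.update e i t) j r)) (Reg.ctr i) =
            List.replicate (t + 1) Sym.bit1 := by simp [mem, hij, List.replicate_succ]
        rw [h₃, update_mem_ctr, Function.update_comm hij.symm, Function.update_idem]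
        rfl
      have h₄ := Fragment.loop_cons (k := .inr (Reg.ctr j)) (read := (id : Sym → Sym)) (ps := [])
        (s := (Sym.bit1 : Sym)) (l := List.replicate r Sym.bit1)
        (S := idle (mem (Function.update (Function.update e i t) j (r + 1)) w))
        (by simp [mem, List.replicate_succ])
        (Fragment.Computes.seq (by simpa [pushed, idle] using h₁) h₂) h₃
      exact h₄.mono (by lia)
  have h₁ := key (e j) 0 w (by simp)
  rw [show Function.update (Function.update e i 0) j (e j) = e by
    rw [← hi]; simp, ← List.range_eq_range'] at h₁
  refine h₁.seq ?_
  refine computes_drain_one ?_ _ ?_ ?_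
  · simpa using hij.symm
  · simp only [idle, update_join_inr, join_inr]
    refine congrArg (join _) (funext fun r => ?_)
    rcases r with _ | _ | k
    · simp [mem, Prog.out]
    · simp [mem]
    · by_cases h : k = j
      · subst h; simp [mem, hij]
      · by_cases h' : k = i
        · subst h'; simp [mem, h, hi]
        · simp [mem, h, h']
  · simp [idle, mem, hij]

theorem eval_mono (p : Polynomial ℕ) {m n : ℕ} (h : m ≤ n) : p.eval m ≤ p.eval n := by
  rw [Polynomial.eval_eq_sum_range, Polynomial.eval_eq_sum_range]
  gcongr

/-- A compiled program writes what it should within the time given by `Prog.cost`. -/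
theorem computes_compile {s : ℕ → List Sym} {T Q : Polynomial ℕ}
    (hT : ∀ n, Nonempty (TM2OutputsInTime A.tm
      ((Computability.unaryEncodeNat n).map A.inputAlphabet.invFun)
      (some ((s n).map A.outputAlphabet.invFun)) (T.eval n)))
    (hQ : ∀ n, (s n).length ≤ Q.eval n) (N : ℕ) (a : Prog) (e : Fin 4 → ℕ)
    (hN : ∀ j, e j ≤ N) (ha : a.Ok e) (w : List Sym) :
    (compile A a).Computes (A.tm.initialState, none) ((a.cost T Q).eval N)
      (idle (mem e w)) (idle (mem e (w ++ a.out s e))) := by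
  induction a generalizing e w with
  | emit w' => simpa [Prog.cost, Prog.out] using computes_emit w' _ e w
  | ones j =>
    refine (computes_ones j _ e w).mono ?_
    have := hN j
    simp [Prog.cost]; lia
  | term j =>
    refine (computes_term j e (hT _) (hQ _) w).mono ?_
    have := hN j
    have := eval_mono T (hN j)
    have := eval_mono Q (hN j)
    simp [Prog.cost]; lia
  | seq a b iha ihb =>
    rw [Prog.cost, Prog.out, Polynomial.eval_add, ← List.append_assoc]
    exact (iha e hN ha.1 w).seq (ihb e hN ha.2 _)
  | loop j i body ih =>
    obtain ⟨hij, hi, hb⟩ := ha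
    refine (computes_loop hij hi (fun t ht w' => ih _ (fun k => ?_) (hb t ht) w') w).mono ?_
    · have := hN j
      have := hN k
      by_cases h : k = j
      · subst h; simp; lia
      · by_cases h' : k = i
        · subst h'; simp [h]; lia
        · simp [h, h', this]
    · have := hN j
      have := Nat.mul_le_mul_right (((body.cost T Q).eval N) + 2) this
      simp [Prog.cost]; lia

end Compile

end StackMachine

namespace StackMachine

open Turing LogicalInduction

/-! ### From programs to efficiently computable sequences -/

section Machine

variable (A : TM2ComputableAux Bool Sym)

/-- Reads the input into the counter `0`, runs the program, and writes its output. -/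
def wholeFragment (a : Prog) : Fragment (ExtAlphabet A.tm) (ExtState A.tm) :=
  (Fragment.loop (.inl A.tm.k₀) (fun _ => Sym.bit1) [toReg A (Reg.ctr 0)] .skip).seq
    ((compile A a).seq ((drain A (Reg.ctr 0) []).seq (drain A Reg.acc
      [⟨.inl A.tm.k₁, fun o => A.outputAlphabet.symm (o.getD Sym.bit1)⟩])))

/-- The extended machine that runs the program. -/
def machine (a : Prog) : FinTM2 :=
  letI := A.tm.kFin
  letI := A.tm.σFin
  letI : Fintype (ExtAlphabet A.tm (.inl A.tm.k₀)) := A.tm.Γk₀Fin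
  { K := A.tm.K ⊕ Reg
    k₀ := .inl A.tm.k₀
    k₁ := .inl A.tm.k₁
    Γ := ExtAlphabet A.tm
    Λ := (wholeFragment A a).Λ
    main := (wholeFragment A a).entry
    σ := ExtState A.tm
    initialState := (A.tm.initialState, none)
    m := (wholeFragment A a).code }

/-- The initial values of the counters. -/
def initEnv (n : ℕ) : Fin 4 → ℕ := Function.update (fun _ => 0) 0 n

variable {A}

/-- A halting configuration has only the output stack filled, hence the clearing of counter `0`. The
accumulator holds the string reversed, and moving it to the output restores the order. -/
theorem computes_wholeFragment {a : Prog} {n C : ℕ} {w : List Sym}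
    (h : (compile A a).Computes (A.tm.initialState, none) C (idle (mem (initEnv n) []))
      (idle (mem (initEnv n) w))) :
    (wholeFragment A a).Computes (A.tm.initialState, none)
      ((2 * n + 1) + (C + ((2 * n + 1) + (2 * w.length + 1))))
      (join (Function.update (fun _ => []) A.tm.k₀
        (List.replicate n (A.inputAlphabet.symm true))) fun _ => [])
      (join (Function.update (fun _ => []) A.tm.k₁ (w.map A.outputAlphabet.symm)) fun _ => []) := by
  refine Fragment.Computes.seq ?_ (h.seq (Fragment.Computes.seq
    (S₂ := idle (mem (fun _ => 0) w)) ?_ ?_))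
  · refine computes_drain_one ?_ _ ?_ ?_
    · simp
    · simp only [idle, update_join_inr, update_join_inl, join_inr, join_inl, Function.update_idem,
        Function.update_self]
      rw [show Function.update (fun _ => []) A.tm.k₀ [] = fun k => ([] : List (A.tm.Γ k)) from
        Function.update_eq_self (f := fun k => ([] : List (A.tm.Γ k))) A.tm.k₀]
      refine congrArg (join _) (funext fun r => ?_)
      rcases r with _ | _ | i
      · simp [mem]
      · simp [mem]
      · by_cases h : i = 0
        · subst h; simp [mem, initEnv]
        · simp [mem, initEnv, h]
    · simp
  · have h₁ := computes_drain (ρ := A.tm.σ) (k := .inr (Reg.ctr 0)) (read := (id : Sym → Sym))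
      (Γ := ExtAlphabet A.tm) (ps := []) (by simp) A.tm.initialState _
      (idle (mem (initEnv n) w)) rfl
    have h₂ : ∀ (l : List Sym) (S : ∀ k, List (ExtAlphabet A.tm k)),
        l.foldl (fun S s => pushed [] (some (id s)) S) S = S := by
      intro l S
      induction l with
      | nil => rfl
      | cons s l ih => exact ih
    refine (h₁.mono (by simp [mem, initEnv])).congr_right ?_
    refine (h₂ _ _).trans ?_
    simp only [idle, update_join_inr, update_mem_ctr_nil]
    simp [initEnv]
  · refine computes_drain_one ?_ _ ?_ ?_
    · simp
    · simp only [idle, update_join_inr, update_join_inl, join_inr, join_inl]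
      congr 1
      · simp [mem]
      · funext r
        rcases r with _ | _ | i <;> simp [mem]
    · simp [mem]

theorem join_update_nil {M : FinTM2} (k : M.K) (l : List (M.Γ k)) :
    join (Function.update (fun _ => []) k l) (fun _ => []) =
      Function.update (fun k => ([] : List (ExtAlphabet M k))) (.inl k) l := by
  rw [← update_join_inl]
  congr 1
  funext x
  rcases x with x | x <;> rfl

theorem exists_outputsInTime_machine {a : Prog} {s : List (A.tm.Γ A.tm.k₀)}
    {s' : List (A.tm.Γ A.tm.k₁)} {t : ℕ}
    (h : (wholeFragment A a).Computes (A.tm.initialState, none) t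
      (join (Function.update (fun _ => []) A.tm.k₀ s) fun _ => [])
      (join (Function.update (fun _ => []) A.tm.k₁ s') fun _ => [])) :
    Nonempty (TM2OutputsInTime (machine A a) s (some s') t) := by
  obtain ⟨n, hn, hr⟩ := h
  rw [join_update_nil, join_update_nil] at hr
  refine ⟨⟨⟨n, ?_⟩, hn⟩⟩
  have h := (runs_iff_iterate _ _ _ _).1 hr
  have h₀ : (initList (machine A a) s).stk = _ := stk_initList (machine A a) s
  have h₁ : (haltList (machine A a) s').stk = _ := stk_haltList (machine A a) s'
  have e₀ : initList (machine A a) s = ⟨some (wholeFragment A a).entry, (A.tm.initialState, none),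
      Function.update (fun _ => []) (.inl A.tm.k₀) s⟩ := congrArg (TM2.Cfg.mk _ _) h₀
  have e₁ : haltList (machine A a) s' = ⟨none, (A.tm.initialState, none),
      Function.update (fun _ => []) (.inl A.tm.k₁) s'⟩ := congrArg (TM2.Cfg.mk _ _) h₁
  exact (congrArg (fun c => (flip bind (machine A a).step)^[n] (some c)) e₀).trans
    (h.trans (congrArg some e₁.symm))

theorem Fragment.exists_length_stk_le {K : Type} [DecidableEq K] {Γ : K → Type} {σ : Type}
    (F : Fragment Γ σ) : ∃ C : ℕ, ∀ {v : σ} {t : ℕ} {S S' : ∀ k, List (Γ k)},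
      F.Computes v t S S' → ∀ k, (S' k).length ≤ (S k).length + t * C := by
  refine ⟨Finset.univ.sup fun l => pushCount (F.code l), fun ⟨n, hn, hr⟩ k => ?_⟩
  refine (hr.length_stk
    (fun l => Finset.le_sup (f := fun l => pushCount (F.code l)) (Finset.mem_univ l)) k).trans ?_
  exact Nat.add_le_add_left (Nat.mul_le_mul_right _ hn) _

/-- Counters never exceed `n`, so each call of the machine for `x` takes time polynomial in `n`; as
the program is fixed, its nested loops multiply this by a polynomial only. -/
theorem efficientlyComputable_of_prog {α β : Type} {f : α → List Sym} {x : ℕ → α}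
    (hx : EfficientlyComputable f x) {g : β → List Sym} {y : ℕ → β} (a : Prog)
    (ha : ∀ n, a.Ok (initEnv n)) (hy : ∀ n, a.out (fun k => f (x k)) (initEnv n) = g (y n)) :
    EfficientlyComputable g y := by
  obtain ⟨hx⟩ := hx
  set A := hx.toTM2ComputableAux with hA
  obtain ⟨c, hc⟩ := exists_length_output_le A.tm
  have hlen : ∀ n, (Computability.unaryEncodeNat n).length = n := fun n => by
    rw [unaryEncodeNat_eq_replicate, List.length_replicate]
  have hT : ∀ n, Nonempty (TM2OutputsInTime A.tm
      ((Computability.unaryEncodeNat n).map A.inputAlphabet.invFun)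
      (some ((f (x n)).map A.outputAlphabet.invFun)) (hx.time.eval n)) := fun n => by
    have := hx.outputsFun n
    rw [hlen] at this
    exact ⟨this⟩
  let Q : Polynomial ℕ := Polynomial.X + hx.time * Polynomial.C c
  have hQ : ∀ n, (f (x n)).length ≤ Q.eval n := fun n => by
    have := hc _ _ _ (hT n)
    simpa [Q, hlen] using this
  have hrun := fun n => computes_compile hT hQ n a (initEnv n)
    (fun j => by by_cases h : j = 0 <;> simp [initEnv, h]) (ha n) []
  simp only [List.nil_append, hy] at hrun
  -- The length of the written string is at most a constant times the running time, which pays for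
  -- the final copying.
  obtain ⟨c', hc'⟩ := (compile A a).exists_length_stk_le
  let R : Polynomial ℕ := a.cost hx.time Q
  have hR : ∀ n, (g (y n)).length ≤ R.eval n * c' := fun n => by
    simpa [mem, idle] using hc' (hrun n) (.inr Reg.acc)
  refine ⟨⟨⟨machine A a, A.inputAlphabet, A.outputAlphabet⟩,
    (2 * .X + 1) + (R + ((2 * .X + 1) + (2 * (R * .C c') + 1))), fun n => ?_⟩⟩
  have hin : (Computability.unaryEncodeNat n).map A.inputAlphabet.symm =
      List.replicate n (A.inputAlphabet.symm true) := by
    rw [unaryEncodeNat_eq_replicate, List.map_replicate]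
  refine (exists_outputsInTime_machine ?_).some
  have h := computes_wholeFragment (hrun n)
  rw [← hin] at h
  refine h.mono ?_
  have := hR n
  rw [hlen]
  simp [R]
  lia

end Machine

end StackMachine

namespace LogicalInduction

open StackMachine

/-! ### Strategies and programs that write them -/

namespace FeatureExpr

variable {S : Type}

/-- The feature `max 0 (a + b ξ)`. -/
def hinge (a b : ℚ) (ξ : FeatureExpr S) : FeatureExpr S :=
  .max (.const 0) (.add (.const a) (.mul (.const b) ξ))

/-- The feature `1 - max 0 (a + b ξ)`. -/
def coHinge (a b : ℚ) (ξ : FeatureExpr S) : FeatureExpr S :=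
  .add (.const 1) (.mul (.const (-1)) (hinge a b ξ))

/-- The product of `f 0, …, f (n - 1)`. -/
def prodRange (n : ℕ) (f : ℕ → FeatureExpr S) : FeatureExpr S :=
  (List.range n).foldr (fun b ζ => FeatureExpr.mul (f b) ζ) (.const 1)

/-- The sum of `f 0, …, f (n - 1)`. -/
def sumRange (n : ℕ) (f : ℕ → FeatureExpr S) : FeatureExpr S :=
  (List.range n).foldr (fun b ζ => FeatureExpr.add (f b) ζ) (.const 0)

theorem toString_prodRange (s : S → List Sym) (n : ℕ) (f : ℕ → FeatureExpr S) :
    (prodRange n f).toString s = ((List.range n).map fun b =>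
      Sym.mul :: (f b).toString s).flatten ++ Sym.const :: ratString 1 := by
  unfold prodRange
  induction List.range n with
  | nil => rfl
  | cons b l ih => simp [toString, ih]

theorem toString_sumRange (s : S → List Sym) (n : ℕ) (f : ℕ → FeatureExpr S) :
    (sumRange n f).toString s = ((List.range n).map fun b =>
      Sym.add :: (f b).toString s).flatten ++ Sym.const :: ratString 0 := by
  unfold sumRange
  induction List.range n with
  | nil => rfl
  | cons b l ih => simp [toString, ih]

theorem eval_prodRange (V : ℕ → S → ℝ) (vals : List ℝ) (n : ℕ) (f : ℕ → FeatureExpr S) :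
    (prodRange n f).eval V vals = ∏ b ∈ Finset.range n, (f b).eval V vals := by
  have h : (prodRange n f).eval V vals =
      ((List.range n).map fun b => (f b).eval V vals).prod := by
    unfold prodRange
    induction List.range n with
    | nil => simp [eval]
    | cons b l ih => simp [eval, ih]
  rw [h]
  rfl

theorem eval_sumRange (V : ℕ → S → ℝ) (vals : List ℝ) (n : ℕ) (f : ℕ → FeatureExpr S) :
    (sumRange n f).eval V vals = ∑ b ∈ Finset.range n, (f b).eval V vals := by
  have h : (sumRange n f).eval V vals =
      ((List.range n).map fun b => (f b).eval V vals).sum := by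
    unfold sumRange
    induction List.range n with
    | nil => simp [eval]
    | cons b l ih => simp [eval, ih]
  rw [h]
  rfl

theorem wellFormed_prodRange {n v k : ℕ} {f : ℕ → FeatureExpr S}
    (h : ∀ b < k, (f b).WellFormed n v) : (prodRange k f).WellFormed n v := by
  have h' : ∀ b ∈ List.range k, (f b).WellFormed n v := fun b hb => h b (List.mem_range.1 hb)
  unfold prodRange
  revert h'
  induction (List.range k) with
  | nil => exact fun _ => trivial
  | cons b l ih => exact fun h' => ⟨h' b (by simp), ih fun b hb => h' b (by simp [hb])⟩

theorem wellFormed_sumRange {n v k : ℕ} {f : ℕ → FeatureExpr S}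
    (h : ∀ b < k, (f b).WellFormed n v) : (sumRange k f).WellFormed n v := by
  have h' : ∀ b ∈ List.range k, (f b).WellFormed n v := fun b hb => h b (List.mem_range.1 hb)
  unfold sumRange
  revert h'
  induction (List.range k) with
  | nil => exact fun _ => trivial
  | cons b l ih => exact fun h' => ⟨h' b (by simp), ih fun b hb => h' b (by simp [hb])⟩

end FeatureExpr

open FeatureExpr

/-- A position in sentences: `σ` shares of each sentence, held together with the amount `o` of
cash. It is worth `o + σ x` if the price of the sentence is `x`. The rational numbers `q < p` are
the thresholds below which the position is bought and above which it is sold. -/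
structure Position where
  o : ℚ
  σ : ℚ
  p : ℚ
  q : ℚ

section Recycling

variable {S : Type} (π : Position) (χ : ℕ → S)

/-- The fraction of a position in `χ i`, bought on day `i`, that is kept until day `i + r`. -/
def keptExpr (i r : ℕ) : FeatureExpr S :=
  prodRange r fun b => coHinge (π.o - π.p) π.σ (.price (χ i) (i + 1 + b))

/-- The position in `χ i` that is held at the end of day `i + 1 + r`. -/
def heldExpr (i r : ℕ) : FeatureExpr S :=
  .mul (.ref i) (.mul (coHinge (π.o - π.p) π.σ (.price (χ i) (i + 1 + r))) (keptExpr π χ i r))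

/-- The position in `χ m` that is bought on day `m`. -/
def boughtExpr (m : ℕ) : FeatureExpr S :=
  .mul (hinge (π.q - π.o) (-π.σ) (.price (χ m) m)) (.add (.const 1) (.mul (.const (-1))
    (sumRange m fun i => heldExpr π χ i (m - 1 - i))))

/-- The number of shares of `χ i` that are bought on day `i + 1 + r`. -/
def soldExpr (i r : ℕ) : FeatureExpr S :=
  .mul (.ref i) (.mul (.const (-π.σ))
    (.mul (hinge (π.o - π.p) π.σ (.price (χ i) (i + 1 + r))) (keptExpr π χ i r)))

/-- Buy `χ n` on day `n` if it is cheap, and sell when it gets dear; never hold more than one share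
in total. -/
def recyclingStrategy (n : ℕ) : Strategy S where
  defs := (List.range n).map (boughtExpr π χ)
  trades := (List.range n).map (fun i => (χ i, soldExpr π χ i (n - 1 - i))) ++
    [(χ n, .mul (.const π.σ) (boughtExpr π χ n))]

/-- Buy a position in `φ` when it is worth less than `c`. -/
def steadyStrategy (c : ℚ) (φ : S) (n : ℕ) : Strategy S where
  defs := []
  trades := [(φ, .mul (.const π.σ) (hinge (c - π.o) (-π.σ) (.price φ n)))]

theorem isTrader_steadyStrategy (c : ℚ) (φ : S) : IsTrader (steadyStrategy π c φ) := by
  intro n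
  refine ⟨fun k h => absurd h (by simp [steadyStrategy]), ?_⟩
  simp [steadyStrategy, hinge, WellFormed]

theorem wellFormed_keptExpr {i r n v : ℕ} (h : i + r ≤ n) : (keptExpr π χ i r).WellFormed n v := by
  refine wellFormed_prodRange fun b hb => ?_
  simp [coHinge, hinge, WellFormed]
  lia

/-- Only variables below `m` occur, so the expression can serve both as definition number `m` and,
inlined, as the trade of day `m`. -/
theorem wellFormed_boughtExpr {m n v : ℕ} (h : m ≤ n) (hv : m ≤ v) :
    (boughtExpr π χ m).WellFormed n v := by
  refine ⟨by simp [hinge, WellFormed, h], trivial, trivial,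
    wellFormed_sumRange fun i hi => ?_⟩
  refine ⟨show i < v by lia, ?_, wellFormed_keptExpr π χ (by lia)⟩
  simp [coHinge, hinge, WellFormed]
  lia

theorem isTrader_recyclingStrategy : IsTrader (recyclingStrategy π χ) := by
  intro n
  refine ⟨fun k h => ?_, fun t ht => ?_⟩
  · simp only [recyclingStrategy, List.length_map, List.length_range] at h
    simpa [recyclingStrategy] using wellFormed_boughtExpr π χ h.le le_rfl
  · simp only [recyclingStrategy, List.mem_append, List.mem_map, List.mem_range,
      List.mem_singleton] at ht
    simp only [recyclingStrategy, List.length_map, List.length_range]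
    obtain ⟨i, hi, rfl⟩ | rfl := ht
    · refine ⟨hi, trivial, ?_, wellFormed_keptExpr π χ (by lia)⟩
      simp [hinge, WellFormed]
      lia
    · exact ⟨trivial, wellFormed_boughtExpr π χ le_rfl le_rfl⟩

/-! #### Programs -/

/-- A constant as a string. -/
def constString (q : ℚ) : List Sym := Sym.const :: ratString q

/-- Writes a hinge of what `ξ` writes. -/
def hingeProg (a b : ℚ) (ξ : Prog) : Prog :=
  .seq (.emit (Sym.max :: (constString 0 ++ Sym.add :: (constString a ++
    Sym.mul :: constString b)))) ξ

/-- Writes one minus a hinge of what `ξ` writes. -/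
def coHingeProg (a b : ℚ) (ξ : Prog) : Prog :=
  .seq (.emit (Sym.add :: (constString 1 ++ Sym.mul :: constString (-1)))) (hingeProg a b ξ)

/-- Writes the price, on day `c₂ + 1 + cₖ`, of the sentence number `c₂`. -/
def laterPriceProg (k : Fin 4) : Prog :=
  .seq (.emit [Sym.price]) (.seq (.ones 2) (.seq (.ones k)
    (.seq (.emit [Sym.bit1, Sym.sep]) (.term 2))))

/-- Writes `keptExpr c₂ cⱼ`. -/
def keptProg (j : Fin 4) : Prog :=
  .seq (.loop j 3 (.seq (.emit [Sym.mul]) (coHingeProg (π.o - π.p) π.σ (laterPriceProg 3))))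
    (.emit (constString 1))

/-- Writes `heldExpr c₂ cⱼ`. -/
def heldProg (j : Fin 4) : Prog :=
  .seq (.emit [Sym.mul, Sym.ref]) (.seq (.ones 2) (.seq (.emit [Sym.sep, Sym.mul])
    (.seq (coHingeProg (π.o - π.p) π.σ (laterPriceProg j)) (keptProg π j))))

/-- Writes `boughtExpr cⱼ`. -/
def boughtProg (j : Fin 4) : Prog :=
  .seq (.emit [Sym.mul]) (.seq (hingeProg (π.q - π.o) (-π.σ)
    (.seq (.emit [Sym.price]) (.seq (.ones j) (.seq (.emit [Sym.sep]) (.term j)))))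
    (.seq (.emit (Sym.add :: (constString 1 ++ Sym.mul :: constString (-1))))
      (.seq (.loop j 2 (.seq (.emit [Sym.add]) (heldProg π j))) (.emit (constString 0)))))

/-- Writes `soldExpr c₂ cⱼ`. -/
def soldProg (j : Fin 4) : Prog :=
  .seq (.emit [Sym.mul, Sym.ref]) (.seq (.ones 2) (.seq
    (.emit (Sym.sep :: Sym.mul :: (constString (-π.σ) ++ [Sym.mul])))
    (.seq (hingeProg (π.o - π.p) π.σ (laterPriceProg j)) (keptProg π j))))

/-- Writes the recycling strategy for day `c₀`. -/
def recyclingProg : Prog :=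
  .seq (.loop 0 1 (.seq (.emit [Sym.define]) (boughtProg π 1)))
    (.seq (.loop 0 2 (.seq (.emit [Sym.trade]) (.seq (.term 2) (soldProg π 0))))
      (.seq (.emit [Sym.trade]) (.seq (.term 0)
        (.seq (.emit (Sym.mul :: constString π.σ)) (boughtProg π 0)))))

/-- Writes the steady strategy for day `c₀`. -/
def steadyProg (c : ℚ) (φ : List Sym) : Prog :=
  .seq (.emit (Sym.trade :: (φ ++ Sym.mul :: constString π.σ)))
    (hingeProg (c - π.o) (-π.σ) (.seq (.emit [Sym.price])
      (.seq (.ones 0) (.emit (Sym.sep :: φ)))))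

variable (s : S → List Sym)

theorem out_steadyProg (s' : ℕ → List Sym) (c : ℚ) (φ : S) (n : ℕ) :
    (steadyProg π c (s φ)).out s' (initEnv n) = (steadyStrategy π c φ n).toString s := by
  simp [steadyProg, steadyStrategy, Strategy.toString, Prog.out, hingeProg, hinge, FeatureExpr.toString,
    constString, initEnv, unaryString]

theorem out_hingeProg {s' : ℕ → List Sym} (a b : ℚ) {ξ : Prog} {e : Fin 4 → ℕ}
    {ζ : FeatureExpr S} (h : ξ.out s' e = ζ.toString s) :
    (hingeProg a b ξ).out s' e = (hinge a b ζ).toString s := by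
  simp [Prog.out, hingeProg, hinge, FeatureExpr.toString, constString, h]

theorem out_coHingeProg {s' : ℕ → List Sym} (a b : ℚ) {ξ : Prog} {e : Fin 4 → ℕ}
    {ζ : FeatureExpr S} (h : ξ.out s' e = ζ.toString s) :
    (coHingeProg a b ξ).out s' e = (coHinge a b ζ).toString s := by
  simp [Prog.out, coHingeProg, out_hingeProg s a b h, coHinge, FeatureExpr.toString, constString]

/-- In unary notation days are added by concatenation: two counters and one more digit. -/
theorem out_laterPriceProg (k : Fin 4) (e : Fin 4 → ℕ) :
    (laterPriceProg k).out (fun i => s (χ i)) e =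
      (price (χ (e 2)) (e 2 + 1 + e k)).toString s := by
  have h : ∀ (i k : ℕ) (w : List Sym), List.replicate (i + 1 + k) Sym.bit1 ++ w =
      List.replicate i Sym.bit1 ++ (List.replicate k Sym.bit1 ++ Sym.bit1 :: w) := fun i k w => by
    rw [show i + 1 + k = i + (k + 1) by lia, List.replicate_add, List.replicate_succ']
    simp
  simp [Prog.out, laterPriceProg, FeatureExpr.toString, unaryString, h]

theorem out_keptProg {j : Fin 4} (hj : j ≠ 2) (hj' : j ≠ 3) (e : Fin 4 → ℕ) :
    (keptProg π j).out (fun i => s (χ i)) e = (keptExpr π χ (e 2) (e j)).toString s := by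
  simp only [keptProg, Prog.out, keptExpr, toString_prodRange]
  congr 3
  refine funext fun b => ?_
  rw [out_coHingeProg s _ _ (out_laterPriceProg χ s 3 _)]
  simp [hj.symm, hj'.symm]

theorem out_heldProg {j : Fin 4} (hj : j ≠ 2) (hj' : j ≠ 3) (e : Fin 4 → ℕ) :
    (heldProg π j).out (fun i => s (χ i)) e = (heldExpr π χ (e 2) (e j)).toString s := by
  simp [heldProg, Prog.out, heldExpr, FeatureExpr.toString, out_keptProg π χ s hj hj',
    out_coHingeProg s _ _ (out_laterPriceProg χ s j _), unaryString]

theorem out_soldProg {j : Fin 4} (hj : j ≠ 2) (hj' : j ≠ 3) (e : Fin 4 → ℕ) :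
    (soldProg π j).out (fun i => s (χ i)) e = (soldExpr π χ (e 2) (e j)).toString s := by
  simp [soldProg, Prog.out, soldExpr, FeatureExpr.toString, out_keptProg π χ s hj hj', constString,
    out_hingeProg s _ _ (out_laterPriceProg χ s j _), unaryString]

/-- While counter `2` runs through `i`, counter `j` has run down to `m - 1 - i`, which is just the
second argument that `heldExpr` needs. -/
theorem out_boughtProg {j : Fin 4} (hj : j ≠ 2) (hj' : j ≠ 3) (e : Fin 4 → ℕ) :
    (boughtProg π j).out (fun i => s (χ i)) e = (boughtExpr π χ (e j)).toString s := by
  have h₁ : (Prog.seq (.emit [Sym.price]) (.seq (.ones j) (.seq (.emit [Sym.sep]) (.term j)))).out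
      (fun i => s (χ i)) e = (price (χ (e j)) (e j)).toString s := by
    simp [Prog.out, FeatureExpr.toString, unaryString]
  have h₂ : ∀ t, (heldProg π j).out (fun i => s (χ i))
      (Function.update (Function.update e 2 t) j (e j - 1 - t)) =
        (heldExpr π χ t (e j - 1 - t)).toString s := fun t => by
    rw [out_heldProg π χ s hj hj']
    simp [hj.symm]
  have h₃ := out_hingeProg s (π.q - π.o) (-π.σ) h₁
  rw [boughtProg]
  simp only [Prog.out] at h₃ ⊢
  simp [h₂, h₃, boughtExpr, FeatureExpr.toString, toString_sumRange, constString]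

theorem out_recyclingProg (n : ℕ) :
    (recyclingProg π).out (fun i => s (χ i)) (initEnv n) =
      (recyclingStrategy π χ n).toString s := by
  simp [recyclingProg, Prog.out, out_boughtProg π χ s, out_soldProg π χ s, recyclingStrategy,
    Strategy.toString, initEnv, FeatureExpr.toString, constString, Function.comp_def]

theorem ok_steadyProg (c : ℚ) (φ : List Sym) (e : Fin 4 → ℕ) : (steadyProg π c φ).Ok e := by
  simp [steadyProg, hingeProg, Prog.Ok]

/-- Nested loops count up on counters of increasing number, so each starts on one that is still
zero. -/
theorem ok_recyclingProg (n : ℕ) : (recyclingProg π).Ok (initEnv n) := by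
  simp [recyclingProg, boughtProg, soldProg, heldProg, keptProg, coHingeProg, hingeProg,
    laterPriceProg, Prog.Ok, initEnv]

theorem efficientlyComputable_recyclingStrategy {χ : ℕ → S} (hχ : EfficientlyComputable s χ) :
    EfficientlyComputable (Strategy.toString s) (recyclingStrategy π χ) :=
  efficientlyComputable_of_prog hχ (recyclingProg π) (ok_recyclingProg π)
    (out_recyclingProg π χ s)

/-- The program calls no term of `χ`, whose machine merely hosts it. -/
theorem efficientlyComputable_steadyStrategy {χ : ℕ → S} (hχ : EfficientlyComputable s χ) (c : ℚ)
    (φ : S) : EfficientlyComputable (Strategy.toString s) (steadyStrategy π c φ) :=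
  efficientlyComputable_of_prog hχ (steadyProg π c (s φ)) (fun _ => ok_steadyProg π c _ _)
    (out_steadyProg π s _ c φ)

end Recycling

end LogicalInduction

namespace LogicalInduction

open Filter

/-! ### The worth of the recycling strategy -/

section Real

variable {p q : ℝ} {u : ℕ → ℕ → ℝ} {v ω : ℕ → ℝ}

/-- The fraction of position number `i` that is kept until day `i + r`, the price of the position
on day `k` being `u i k`. -/
noncomputable def kept (p : ℝ) (u : ℕ → ℕ → ℝ) (i r : ℕ) : ℝ :=
  ∏ b ∈ Finset.range r, (1 - max 0 (u i (i + 1 + b) - p))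

theorem kept_succ (i r : ℕ) :
    kept p u i (r + 1) = kept p u i r * (1 - max 0 (u i (i + 1 + r) - p)) :=
  Finset.prod_range_succ _ _

/-- The amounts `v m` bought on day `m` by the recycling strategy. -/
structure IsRecycling (p q : ℝ) (u : ℕ → ℕ → ℝ) (v : ℕ → ℝ) : Prop where
  p_nonneg : 0 ≤ p
  p_le_one : p ≤ 1
  q_le_one : q ≤ 1
  u_nonneg : ∀ i k, 0 ≤ u i k
  u_le_one : ∀ i k, u i k ≤ 1
  eq : ∀ m, v m = max 0 (q - u m m) *
    (1 - ∑ i ∈ Finset.range m, v i * kept p u i (m - i))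

namespace IsRecycling

theorem sold_nonneg (i k : ℕ) : 0 ≤ max 0 (u i k - p) := le_max_left _ _

variable (h : IsRecycling p q u v)
include h

theorem sold_le_one (i k : ℕ) : max 0 (u i k - p) ≤ 1 :=
  max_le zero_le_one (by linarith [h.u_le_one i k, h.p_nonneg])

theorem kept_nonneg (i r : ℕ) : 0 ≤ kept p u i r :=
  Finset.prod_nonneg fun _ _ => sub_nonneg.2 (h.sold_le_one _ _)

theorem kept_succ_le (i r : ℕ) : kept p u i (r + 1) ≤ kept p u i r := by
  rw [kept_succ]
  exact mul_le_of_le_one_right (h.kept_nonneg i r)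
    (by linarith [sold_nonneg (p := p) (u := u) i (i + 1 + r)])

theorem kept_le_one (i r : ℕ) : kept p u i r ≤ 1 := by
  induction r with
  | zero => simp [kept]
  | succ r ih => exact (h.kept_succ_le i r).trans ih

/-- Sales only shrink holdings, and a purchase takes at most the free capital because the hinge is
at most one. The two claims need each other in the induction. -/
theorem nonneg_and_held_le (m : ℕ) : (∀ i ≤ m, 0 ≤ v i) ∧
    ∑ i ∈ Finset.range (m + 1), v i * kept p u i (m - i) ≤ 1 := by
  have hβ : ∀ m, max 0 (q - u m m) ≤ 1 := fun m =>
    max_le zero_le_one (by linarith [h.u_nonneg m m, h.q_le_one])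
  have hβ' : ∀ m, 0 ≤ max 0 (q - u m m) := fun m => le_max_left _ _
  induction m with
  | zero =>
    have h₀ := h.eq 0
    simp only [Finset.range_zero, Finset.sum_empty, sub_zero, mul_one] at h₀
    refine ⟨fun i hi => ?_, ?_⟩
    · obtain rfl : i = 0 := by lia
      rw [h₀]; exact hβ' 0
    · simpa [kept, h₀] using hβ 0
  | succ m ih =>
    have hle : ∑ i ∈ Finset.range (m + 1), v i * kept p u i (m + 1 - i) ≤ 1 := by
      refine (Finset.sum_le_sum fun i hi => ?_).trans ih.2
      have hi := Finset.mem_range_succ_iff.1 hi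
      rw [show m + 1 - i = m - i + 1 by lia]
      exact mul_le_mul_of_nonneg_left (h.kept_succ_le _ _) (ih.1 i hi)
    refine ⟨fun i hi => ?_, ?_⟩
    · rcases hi.eq_or_lt with rfl | hi
      · rw [h.eq]
        exact mul_nonneg (hβ' _) (by linarith)
      · exact ih.1 i (by lia)
    · rw [Finset.sum_range_succ, Nat.sub_self, h.eq (m + 1)]
      have := mul_le_of_le_one_left (show 0 ≤ 1 - ∑ i ∈ Finset.range (m + 1),
        v i * kept p u i (m + 1 - i) by linarith) (hβ (m + 1))
      simp only [kept, Finset.range_zero, Finset.prod_empty, mul_one] at this ⊢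
      linarith

theorem nonneg (m : ℕ) : 0 ≤ v m := (h.nonneg_and_held_le m).1 m le_rfl

/-- Shares are sold only above `p`, and those still held number at most one in total, so valuing
everything bought at `p` overstates the worth by at most one. -/
theorem worth_ge (hω : ∀ i, 0 ≤ ω i) (N : ℕ) :
    ∑ i ∈ Finset.range (N + 1), v i * (p - u i i) - 1 ≤
      ∑ n ∈ Finset.range (N + 1), (∑ i ∈ Finset.range n,
        -(v i * (max 0 (u i n - p) * kept p u i (n - 1 - i))) * (ω i - u i n) +
          v n * (ω n - u n n)) := by
  -- Sold shares are booked at `p`, kept ones at `ω i`.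
  have key : ∑ i ∈ Finset.range (N + 1), (v i * (p - u i i) +
      v i * kept p u i (N - i) * (ω i - p)) ≤ ∑ n ∈ Finset.range (N + 1), (∑ i ∈ Finset.range n,
        -(v i * (max 0 (u i n - p) * kept p u i (n - 1 - i))) * (ω i - u i n) +
          v n * (ω n - u n n)) := by
    induction N with
    | zero => simp [kept]; linarith
    | succ N ih =>
      rw [Finset.sum_range_succ _ (N + 1), Finset.sum_range_succ _ (N + 1)]
      have h₁ : ∑ i ∈ Finset.range (N + 1), (v i * (p - u i i) +
          v i * kept p u i (N + 1 - i) * (ω i - p)) ≤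
          ∑ i ∈ Finset.range (N + 1), (v i * (p - u i i) +
            v i * kept p u i (N - i) * (ω i - p)) +
          ∑ i ∈ Finset.range (N + 1),
            -(v i * (max 0 (u i (N + 1) - p) * kept p u i (N + 1 - 1 - i))) *
              (ω i - u i (N + 1)) := by
        rw [← Finset.sum_add_distrib]
        refine Finset.sum_le_sum fun i hi => ?_
        have hi := Finset.mem_range_succ_iff.1 hi
        rw [show N + 1 - i = N - i + 1 by lia, show N + 1 - 1 - i = N - i by lia, kept_succ,
          show i + 1 + (N - i) = N + 1 by lia]
        -- This is the surplus over `p` from the sales of day `N + 1`.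
        have h₂ : 0 ≤ max 0 (u i (N + 1) - p) * (u i (N + 1) - p) := by
          rcases le_total (u i (N + 1) - p) 0 with hle | hle
          · simp [hle]
          · rw [max_eq_right hle]; exact mul_self_nonneg _
        have h₃ := mul_nonneg (mul_nonneg (h.nonneg i) (h.kept_nonneg i (N - i))) h₂
        nlinarith
      have h₂ : kept p u (N + 1) (N + 1 - (N + 1)) = 1 := by simp [kept]
      rw [h₂]
      linarith
  refine le_trans ?_ key
  rw [Finset.sum_add_distrib]
  have h₁ : -1 ≤ ∑ i ∈ Finset.range (N + 1), v i * kept p u i (N - i) * (ω i - p) := by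
    have h₂ := (h.nonneg_and_held_le N).2
    have h₃ : ∑ i ∈ Finset.range (N + 1), -(v i * kept p u i (N - i)) ≤
        ∑ i ∈ Finset.range (N + 1), v i * kept p u i (N - i) * (ω i - p) := by
      refine Finset.sum_le_sum fun i _ => ?_
      have := mul_nonneg (h.nonneg i) (h.kept_nonneg i (N - i))
      nlinarith [hω i, h.p_le_one]
    rw [Finset.sum_neg_distrib] at h₃
    linarith
  linarith

theorem bought_gain_ge {ε : ℝ} (hq : q ≤ p - ε) (i : ℕ) :
    ε * v i ≤ v i * (p - u i i) := by
  by_cases hi : q ≤ u i i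
  · have : v i = 0 := by rw [h.eq, max_eq_left (by linarith), zero_mul]
    simp [this]
  · rw [mul_comm]
    exact mul_le_mul_of_nonneg_left (by linarith) (h.nonneg i)

/-- From some day on at least the fraction `c - p` of the remainder is sold daily, so the decay is
geometric. -/
theorem tendsto_kept {c : ℝ} (hc : p < c) {i : ℕ} (hi : ∀ᶠ k in atTop, c ≤ u i k) :
    Tendsto (kept p u i) atTop (nhds 0) := by
  obtain ⟨K, hK⟩ := eventually_atTop.1 hi
  have hc1 : c ≤ 1 := (hK K le_rfl).trans (h.u_le_one _ _)
  have hle : ∀ r, kept p u i (K + r) ≤ (1 - (c - p)) ^ r := fun r => by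
    induction r with
    | zero => simpa using h.kept_le_one i K
    | succ r ih =>
      rw [← add_assoc, kept_succ, pow_succ]
      refine mul_le_mul ih ?_ (sub_nonneg.2 (h.sold_le_one _ _)) ((h.kept_nonneg _ _).trans ih)
      have := hK (i + 1 + (K + r)) (by lia)
      linarith [le_max_right 0 (u i (i + 1 + (K + r)) - p)]
  rw [← tendsto_add_atTop_iff_nat K]
  have hpow : Tendsto (fun r : ℕ => (1 - (c - p)) ^ r) atTop (nhds 0) :=
    tendsto_pow_atTop_nhds_zero_of_lt_one (by linarith [h.p_nonneg]) (by linarith)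
  refine squeeze_zero (fun r => h.kept_nonneg _ _) (fun r => ?_) hpow
  rw [add_comm]
  exact hle r

/-- If the purchases were summable, those after some day `J` would total less than `1 / 4`, and
those before `J` would be sold off to less than `1 / 4`. Half of the capital would then be free on
cheap days, contradicting that purchases tend to zero. -/
theorem not_bddAbove_sum {c δ : ℝ} (hc : p < c) (hqp : q ≤ p) (hδ : 0 < δ)
    (hu : ∀ i, u i i < p → ∀ᶠ k in atTop, c ≤ u i k)
    (hf : ∃ᶠ m in atTop, u m m ≤ q - δ) :
    ¬ BddAbove (Set.range fun N => ∑ i ∈ Finset.range N, v i) := by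
  intro hb
  have hs : Summable v := by
    obtain ⟨C, hC⟩ := hb
    exact summable_of_sum_range_le h.nonneg fun n => hC ⟨n, rfl⟩
  have hv0 := hs.tendsto_atTop_zero
  obtain ⟨J, hJ⟩ : ∃ J, ∑' i, v (i + J) < 1 / 4 :=
    ((tendsto_sum_nat_add v).eventually_lt_const (by norm_num)).exists
  have hterm : ∀ j, Tendsto (fun m => v j * kept p u j (m - j)) atTop (nhds 0) := fun j => by
    by_cases hj : u j j < p
    · have := ((h.tendsto_kept hc (hu j hj)).comp (tendsto_sub_atTop_nat j)).const_mul (v j)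
      simpa [Function.comp_def] using this
    · have : v j = 0 := by rw [h.eq, max_eq_left (by linarith), zero_mul]
      simp [this]
  have hhead : Tendsto (fun m => ∑ j ∈ Finset.range J, v j * kept p u j (m - j)) atTop (nhds 0) := by
    simpa using tendsto_finsetSum (Finset.range J) fun j _ => hterm j
  have hev := (hhead.eventually_lt_const (show (0 : ℝ) < 1 / 4 by norm_num)).and
    ((hv0.eventually_lt_const (show 0 < δ / 2 by linarith)).and (eventually_ge_atTop J))
  obtain ⟨m, hm, h₁, h₂, h₃⟩ := (hf.and_eventually hev).exists
  have h₄ : ∑ i ∈ Finset.range m, v i * kept p u i (m - i) ≤ 1 / 2 := by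
    obtain ⟨d, rfl⟩ := Nat.exists_eq_add_of_le h₃
    rw [Finset.sum_range_add]
    have h₅ : ∑ x ∈ Finset.range d, v (J + x) * kept p u (J + x) (J + d - (J + x)) ≤
        ∑' i, v (i + J) := by
      refine (Finset.sum_le_sum fun x _ => ?_).trans
        (((summable_nat_add_iff J).2 hs).sum_le_tsum (Finset.range d) fun i _ => h.nonneg _)
      rw [add_comm J x]
      exact mul_le_of_le_one_right (h.nonneg _) (h.kept_le_one _ _)
    linarith
  have h₅ := h.eq m
  have h₆ : δ ≤ max 0 (q - u m m) := le_max_of_le_right (by linarith)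
  nlinarith

end IsRecycling

end Real

end LogicalInduction

namespace LogicalInduction

open FeatureExpr Filter

/-! ### The strategies as real-valued formulas -/

section Evaluate

variable {S : Type} (π : Position) (χ : ℕ → S) (V : ℕ → S → ℝ)

/-- The values of the variables defined by `f 0, …, f (n - 1)`. -/
noncomputable def defVals (f : ℕ → FeatureExpr S) : ℕ → List ℝ
  | 0 => []
  | n + 1 => defVals f n ++ [(f n).eval V (defVals f n)]

/-- The definitions do not depend on the day, so variable `i` has the same value in the strategies
of all days after `i`: the past purchase. -/
theorem vals_eq_defVals (f : ℕ → FeatureExpr S) (n : ℕ) (t : List (S × FeatureExpr S)) :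
    Strategy.vals ⟨(List.range n).map f, t⟩ V = defVals V f n := by
  induction n with
  | zero => rfl
  | succ n ih =>
    simp only [Strategy.vals] at ih
    simp [Strategy.vals, List.range_succ, defVals, ih]

theorem defVals_eq_map (f : ℕ → FeatureExpr S) (n : ℕ) :
    defVals V f n = (List.range n).map fun m => (f m).eval V (defVals V f m) := by
  induction n with
  | zero => rfl
  | succ n ih => rw [List.range_succ, List.map_append, ← ih]; rfl

theorem getD_defVals (f : ℕ → FeatureExpr S) {i n : ℕ} (h : i < n) :
    (defVals V f n).getD i 0 = (f i).eval V (defVals V f i) := by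
  rw [defVals_eq_map]
  simp [List.getD, h]

/-- The price on day `k` of the position in `χ i`. -/
noncomputable def positionPrice (i k : ℕ) : ℝ := π.o + π.σ * V k (χ i)

/-- The amount that the recycling strategy buys on day `m`. -/
noncomputable def bought (m : ℕ) : ℝ :=
  (boughtExpr π χ m).eval V (defVals V (boughtExpr π χ) m)

theorem eval_keptExpr (l : List ℝ) (i r : ℕ) :
    (keptExpr π χ i r).eval V l = kept π.p (positionPrice π χ V) i r := by
  rw [keptExpr, eval_prodRange, kept]
  refine Finset.prod_congr rfl fun b _ => ?_
  simp only [coHinge, hinge, eval, positionPrice]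
  push_cast
  rw [neg_one_mul, ← sub_eq_add_neg, sub_add_eq_add_sub]

theorem bought_eq (m : ℕ) : bought π χ V m = max 0 (π.q - positionPrice π χ V m m) *
    (1 - ∑ i ∈ Finset.range m, bought π χ V i * kept π.p (positionPrice π χ V) i (m - i)) := by
  rw [bought, boughtExpr]
  simp only [eval, hinge, eval_sumRange]
  congr 1
  · push_cast
    rw [positionPrice]
    congr 1
    ring
  · push_cast
    rw [neg_one_mul, ← sub_eq_add_neg]
    refine congrArg _ (Finset.sum_congr rfl fun i hi => ?_)
    have hi := Finset.mem_range.1 hi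
    -- `heldExpr` keeps the factor of day `m` apart: sales of day `m` free capital for the purchase
    -- of the same day.
    rw [show m - i = m - 1 - i + 1 by lia, kept_succ]
    simp only [heldExpr, coHinge, hinge, eval, eval_keptExpr, getD_defVals _ _ hi, positionPrice,
      bought]
    push_cast
    rw [sub_add_eq_add_sub]
    ring

theorem value_recyclingStrategy (n : ℕ) (W : S → Bool) :
    (recyclingStrategy π χ n).value n V W =
      (∑ i ∈ Finset.range n, -(bought π χ V i * (max 0 (positionPrice π χ V i n - π.p) *
        kept π.p (positionPrice π χ V) i (n - 1 - i))) *
          (π.o + π.σ * (if W (χ i) then 1 else 0) - positionPrice π χ V i n)) +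
      bought π χ V n *
        (π.o + π.σ * (if W (χ n) then 1 else 0) - positionPrice π χ V n n) := by
  have hv : (recyclingStrategy π χ n).vals V = defVals V (boughtExpr π χ) n :=
    vals_eq_defVals V _ _ _
  rw [Strategy.value, hv]
  simp only [recyclingStrategy, List.map_append, List.sum_append, List.map_map]
  congr 1
  · change ∑ i ∈ Finset.range n, _ = _
    refine Finset.sum_congr rfl fun i hi => ?_
    have hi := Finset.mem_range.1 hi
    simp only [Function.comp, soldExpr, eval, hinge, eval_keptExpr, getD_defVals _ _ hi,
      positionPrice, bought, show i + 1 + (n - 1 - i) = n by lia]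
    push_cast
    rw [sub_add_eq_add_sub]
    ring
  · simp only [List.map_cons, List.map_nil, List.sum_singleton, eval, bought, positionPrice]
    ring

theorem value_steadyStrategy (c : ℚ) (φ : S) (n : ℕ) (W : S → Bool) :
    (steadyStrategy π c φ n).value n V W = max 0 (c - (π.o + π.σ * V n φ)) *
      (π.o + π.σ * (if W φ then 1 else 0) - (π.o + π.σ * V n φ)) := by
  simp only [Strategy.value, steadyStrategy, hinge, eval, List.map_cons, List.map_nil,
    List.sum_singleton]
  push_cast
  rw [show (c : ℝ) - π.o + -π.σ * V n φ = c - (π.o + π.σ * V n φ) by ring]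
  ring

end Evaluate

/-- The position is one share of each sentence, or one share short with one unit of cash. -/
def Position.IsUnit (π : Position) : Prop := (π.o = 0 ∧ π.σ = 1) ∨ (π.o = 1 ∧ π.σ = -1)

theorem Position.IsUnit.mem_Icc {π : Position} (h : π.IsUnit) {x : ℝ} (hx : x ∈ Set.Icc 0 1) :
    π.o + π.σ * x ∈ Set.Icc (0 : ℝ) 1 := by
  obtain ⟨h₀, h₁⟩ := hx
  obtain ⟨ho, hs⟩ | ⟨ho, hs⟩ := h <;> rw [ho, hs] <;> constructor <;> push_cast <;> linarith

theorem Position.IsUnit.ite_mem_Icc {π : Position} (h : π.IsUnit) (b : Bool) :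
    π.o + π.σ * (if b then 1 else 0 : ℝ) ∈ Set.Icc (0 : ℝ) 1 :=
  h.mem_Icc (by cases b <;> simp)

/-! ### What the induction criterion forces on prices -/

section Criterion

variable {L : FirstOrder.Language.{0, 0}} [∀ n, Encodable (L.Functions n)]
  [∀ n, Encodable (L.Relations n)] {P : ℕ → L.Sentence → ℚ} {D : ℕ → Finset L.Sentence}
  {π : Position} {χ : ℕ → L.Sentence}

/-- The price of a position that is worth one in the limit tends to one. -/
theorem eventually_le_price_of_settled (hP : ∀ n φ, P n φ ∈ Set.Icc (0 : ℚ) 1)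
    (hD : ∀ n, (PC (D n : Set L.Sentence)).Nonempty) (hlic : LogicalInductionCriterion P D)
    (hχ : EfficientlyComputable sentenceString χ) (hπ : π.IsUnit) (φ : L.Sentence) {N : ℕ}
    (hN : ∀ n ≥ N, ∀ W ∈ PC (D n : Set L.Sentence),
      (π.o + π.σ * (if W φ then 1 else 0) : ℝ) = 1) {c : ℝ} (hc : c < 1) :
    ∀ᶠ n in atTop, c ≤ π.o + π.σ * (P n φ : ℝ) := by
  by_contra hcon
  -- The trader buys below `c'`: the gap `1 - c'` is profit per unit, and `c' - c` is the least
  -- amount bought on a day with price below `c`.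
  obtain ⟨c', hcc', hc'⟩ := exists_rat_btwn hc
  have hu : ∀ n, (π.o + π.σ * (P n φ : ℝ)) ∈ Set.Icc (0 : ℝ) 1 := fun n =>
    hπ.mem_Icc ⟨by exact_mod_cast (hP n φ).1, by exact_mod_cast (hP n φ).2⟩
  set u : ℕ → ℝ := fun n => π.o + π.σ * (P n φ : ℝ) with hu_def
  have hβ : ∀ n, 0 ≤ max 0 (c' - u n) ∧ max 0 (c' - u n) ≤ 1 := fun n =>
    ⟨le_max_left _ _, max_le zero_le_one (by linarith [(hu n).1])⟩
  have hval : ∀ n W, (steadyStrategy π c' φ n).value n (fun n φ => (P n φ : ℝ)) W =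
      max 0 (c' - u n) * ((π.o + π.σ * (if W φ then 1 else 0)) - u n) := fun n W =>
    value_steadyStrategy π _ c' φ n W
  have hge : ∀ (n : ℕ) (W : World L), -1 ≤ max 0 (c' - u n) * ((π.o + π.σ * (if W φ then 1 else 0)) - u n) :=
    fun n W => by
      have h₁ := (hπ.ite_mem_Icc (W φ)).1
      have h₂ : u n ≤ 1 := (hu n).2
      have h₃ := mul_nonneg (hβ n).1
        (show 0 ≤ (π.o + π.σ * (if W φ then 1 else 0)) - u n + 1 by linarith)
      linarith [(hβ n).2]
  have hge' : ∀ (n : ℕ) (W : World L), (π.o + π.σ * (if W φ then 1 else 0) : ℝ) = 1 →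
      (1 - c') * max 0 (c' - u n) ≤
        max 0 (c' - u n) * ((π.o + π.σ * (if W φ then 1 else 0)) - u n) := fun n W hW => by
    rw [hW]
    rcases le_total (c' - u n) 0 with h | h
    · simp [h]
    · rw [max_eq_right h]; nlinarith
  -- Once day `N` is reached, all plausible worlds value the position at one, so even the early
  -- trades show no loss. Before that, at most `N` trades have been made, each losing at most one.
  have hlow : ∀ n, ∀ W ∈ PC (D n : Set L.Sentence),
      -(N + 1) + ∑ i ∈ Finset.range (n + 1), (if N ≤ i then (1 - c') * max 0 (c' - u i) else 0) ≤
        ∑ i ∈ Finset.range (n + 1),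
          (steadyStrategy π c' φ i).value i (fun n φ => (P n φ : ℝ)) W := by
    intro n W hW
    simp only [hval]
    rcases le_or_gt N n with hn | hn
    · have h₁ := Finset.sum_le_sum fun i (_ : i ∈ Finset.range (n + 1)) =>
        (show (if N ≤ i then (1 - c') * max 0 (c' - u i) else 0) ≤ _ from
          le_trans (by
            split_ifs
            · rfl
            · exact mul_nonneg (by linarith) (hβ i).1) (hge' i W (hN n hn W hW)))
      have : (0 : ℝ) ≤ N := N.cast_nonneg
      linarith
    · have h₁ := Finset.sum_le_sum fun i (_ : i ∈ Finset.range (n + 1)) => hge i W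
      have h₂ : ∑ i ∈ Finset.range (n + 1),
          (if N ≤ i then (1 - c') * max 0 (c' - u i) else 0) = 0 :=
        Finset.sum_eq_zero fun i hi => if_neg (by have := Finset.mem_range.1 hi; lia)
      simp only [Finset.sum_const, Finset.card_range, nsmul_eq_mul] at h₁
      have : (n : ℝ) ≤ N := by exact_mod_cast hn.le
      push_cast at h₁
      linarith
  refine hlic _ (isTrader_steadyStrategy π c' φ)
    (efficientlyComputable_steadyStrategy π sentenceString hχ c' φ) ⟨⟨-(N + 1), ?_⟩, ?_⟩
  · rintro x ⟨n, W, hW, rfl⟩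
    refine le_trans ?_ (hlow n W hW)
    have := Finset.sum_nonneg (s := Finset.range (n + 1))
      (f := fun i => if N ≤ i then (1 - c') * max 0 (c' - u i) else 0) fun i _ => by
        split_ifs
        · exact mul_nonneg (by linarith) (hβ i).1
        · rfl
    linarith
  · rintro ⟨B, hB⟩
    -- Bounded worth would make the gains summable, hence null, but they exceed a fixed amount on
    -- each day with price below `c`.
    have hs : Summable fun i => if N ≤ i then (1 - c') * max 0 (c' - u i) else 0 := by
      refine summable_of_sum_range_le (c := B + (N + 1)) (fun i => ?_) fun n => ?_
      · split_ifs
        · exact mul_nonneg (by linarith) (hβ i).1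
        · rfl
      · refine le_trans (Finset.sum_le_sum_of_subset_of_nonneg
          (Finset.range_mono n.le_succ) fun i _ _ => ?_) ?_
        · split_ifs
          · exact mul_nonneg (by linarith) (hβ i).1
          · rfl
        · obtain ⟨W, hW⟩ := hD n
          linarith [hlow n W hW, hB ⟨n, W, hW, rfl⟩]
    have hev := (hs.tendsto_atTop_zero.eventually_lt_const
      (show 0 < (1 - c') * (c' - c) from mul_pos (by linarith) (by linarith))).and
      (eventually_ge_atTop N)
    obtain ⟨n, hn, h₁, h₂⟩ := ((not_eventually.1 hcon).and_eventually hev).exists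
    rw [if_pos h₂] at h₁
    have h₃ : c' - c ≤ max 0 (c' - u n) := le_max_of_le_right (by linarith [not_le.1 hn])
    have := mul_le_mul_of_nonneg_left h₃ (show (0 : ℝ) ≤ 1 - c' by linarith)
    linarith

/-- If a position in `χ n` turns out to be worth one whenever its price on day `n` is less than
`π.p`, then its price on day `n` is asymptotically at least `π.p`. -/
theorem eventually_le_price_of_recycling (hP : ∀ n φ, P n φ ∈ Set.Icc (0 : ℚ) 1)
    (hD : ∀ n, (PC (D n : Set L.Sentence)).Nonempty) (hlic : LogicalInductionCriterion P D)
    (hχ : EfficientlyComputable sentenceString χ) (hπ : π.IsUnit) (hp : π.p ∈ Set.Ioo 0 1)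
    (hq : π.q < π.p)
    (hN : ∀ i, (π.o + π.σ * (P i (χ i) : ℝ)) < π.p → ∃ N, ∀ n ≥ N,
      ∀ W ∈ PC (D n : Set L.Sentence), (π.o + π.σ * (if W (χ i) then 1 else 0) : ℝ) = 1)
    {δ : ℝ} (hδ : 0 < δ) :
    ∀ᶠ n in atTop, π.q - δ ≤ π.o + π.σ * (P n (χ n) : ℝ) := by
  by_contra hcon
  have hp₀ : (0 : ℝ) < π.p := by exact_mod_cast hp.1
  have hp₁ : (π.p : ℝ) < 1 := by exact_mod_cast hp.2
  have hq' : (π.q : ℝ) < π.p := by exact_mod_cast hq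
  set V : ℕ → L.Sentence → ℝ := fun n φ => (P n φ : ℝ) with hV
  have hu : ∀ i k, positionPrice π χ V i k ∈ Set.Icc (0 : ℝ) 1 := fun i k =>
    hπ.mem_Icc (x := (P k (χ i) : ℝ))
      ⟨by exact_mod_cast (hP k (χ i)).1, by exact_mod_cast (hP k (χ i)).2⟩
  have hr : IsRecycling π.p π.q (positionPrice π χ V) (bought π χ V) :=
    ⟨hp₀.le, hp₁.le, (hq'.trans hp₁).le, fun i k => (hu i k).1, fun i k => (hu i k).2,
      bought_eq π χ V⟩
  have hworth : ∀ n (W : World L), (π.p - π.q) * ∑ i ∈ Finset.range (n + 1), bought π χ V i - 1 ≤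
      ∑ i ∈ Finset.range (n + 1), (recyclingStrategy π χ i).value i V W := fun n W => by
    refine le_trans ?_ ((hr.worth_ge (ω := fun i => π.o + π.σ * (if W (χ i) then 1 else 0))
      (fun i => (hπ.ite_mem_Icc (W (χ i))).1) n).trans_eq
      (Finset.sum_congr rfl fun i _ => (value_recyclingStrategy π χ V i W).symm))
    rw [Finset.mul_sum]
    exact sub_le_sub_right (Finset.sum_le_sum fun i _ => hr.bought_gain_ge (by linarith) i) 1
  -- Any level strictly between `π.p` and one will do; the midpoint is taken.
  have hunb := hr.not_bddAbove_sum (c := (π.p + 1) / 2) (by linarith) hq'.le hδ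
    (fun i hi => ?_) ?_
  · refine hlic _ (isTrader_recyclingStrategy π χ)
      (efficientlyComputable_recyclingStrategy π sentenceString hχ) ⟨⟨-1, ?_⟩, ?_⟩
    · rintro x ⟨n, W, hW, rfl⟩
      refine le_trans ?_ (hworth n W)
      have := mul_nonneg (show (0 : ℝ) ≤ π.p - π.q by linarith)
        (Finset.sum_nonneg (s := Finset.range (n + 1)) fun i _ => hr.nonneg i)
      linarith
    · rintro ⟨B, hB⟩
      refine hunb ⟨(B + 1) / (π.p - π.q), ?_⟩
      rintro _ ⟨N, rfl⟩
      obtain ⟨W, hW⟩ := hD N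
      have h₁ := (hworth N W).trans (hB ⟨N, W, hW, rfl⟩)
      have h₂ := hr.nonneg N
      rw [Finset.sum_range_succ] at h₁
      dsimp only
      rw [le_div_iff₀ (by linarith)]
      nlinarith
  · obtain ⟨N, hN⟩ := hN i hi
    exact eventually_le_price_of_settled hP hD hlic hχ hπ (χ i) hN (by linarith)
  · exact (not_eventually.1 hcon).mono fun n hn => (not_le.1 hn).le

end Criterion

end LogicalInduction

namespace LogicalInduction

open FirstOrder FirstOrder.Language Filter

/-! ### Worlds and provability -/

section Worlds

variable {L : FirstOrder.Language.{0, 0}} {Γ : Set L.Sentence}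

theorem Proves.sound {φ : L.Sentence} (h : Proves Γ φ) {W : World L} (hW : W ∈ PC Γ) :
    W φ = true := by
  induction h with
  | ax h => exact hW.2 _ h
  | taut h => exact h W hW.1
  | mp _ _ ih₁ ih₂ => rw [hW.1.imp, ih₂] at ih₁; simpa using ih₁

theorem PropConsistent.not {W : World L} (hW : PropConsistent W) (φ : L.Sentence) :
    W (BoundedFormula.not φ) = !W φ := by
  rw [BoundedFormula.not, hW.imp]
  simp [hW.falsum]

theorem PropConsistent.iff {W : World L} (hW : PropConsistent W) (φ ψ : L.Sentence) :
    W (BoundedFormula.iff φ ψ) = (W φ == W ψ) := by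
  have : ∀ a b : L.Sentence, W (a ⊓ b) = (W a && W b) := fun a b => by
    change W (BoundedFormula.not (a.imp (BoundedFormula.not b))) = _
    rw [hW.not, hW.imp, hW.not]
    simp
  rw [BoundedFormula.iff, this, hW.imp, hW.imp]
  cases W φ <;> cases W ψ <;> rfl

/-- Each condition involves finitely many coordinates of the product `L.Sentence → Bool`, which is
compact by Tychonoff's theorem. -/
theorem isClosed_PC (A : Set L.Sentence) : IsClosed (PC A) := by
  have h : PC A = ({W | W ⊥ = false} ∩ ⋂ (φ : L.Sentence) (ψ : L.Sentence),
      {W : World L | W (φ.imp ψ) = (!W φ || W ψ)}) ∩ ⋂ φ ∈ A, {W | W φ = true} := by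
    ext W
    simp only [PC, Set.mem_ofPred_eq, Set.mem_inter_iff, Set.mem_iInter]
    exact and_congr_left' ⟨fun h => ⟨h.falsum, h.imp⟩, fun h => ⟨h.1, h.2⟩⟩
  rw [h]
  refine .inter (.inter (isClosed_eq (continuous_apply _) continuous_const)
    (isClosed_iInter fun φ => isClosed_iInter fun ψ => isClosed_eq (continuous_apply _) ?_))
    (isClosed_biInter fun φ _ => isClosed_eq (continuous_apply _) continuous_const)
  have h₁ : Continuous fun p : Bool × Bool => (!p.1 || p.2) := continuous_of_discreteTopology
  have h₂ : Continuous fun W : World L => (W φ, W ψ) :=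
    (continuous_apply φ).prodMk (continuous_apply ψ)
  exact h₁.comp h₂

/-- Compactness of propositional logic, for an increasing sequence of sets. -/
theorem exists_PC_settled {D : ℕ → Finset L.Sentence} (hD : Monotone D) {φ : L.Sentence} {b : Bool}
    (h : ∀ W ∈ PC (⋃ n, (D n : Set L.Sentence)), W φ = b) :
    ∃ N, ∀ n ≥ N, ∀ W ∈ PC (D n : Set L.Sentence), W φ = b := by
  by_contra hcon
  push Not at hcon
  have hanti : ∀ m n, m ≤ n → PC (D n : Set L.Sentence) ⊆ PC (D m) := fun m n hmn W hW =>
    ⟨hW.1, fun ψ hψ => hW.2 ψ (hD hmn hψ)⟩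
  have hφ : Continuous fun W : World L => W φ := continuous_apply φ
  have hcl : ∀ n, IsClosed (PC (D n : Set L.Sentence) ∩ {W | W φ ≠ b}) := fun n =>
    (isClosed_PC _).inter ((isClosed_discrete ({b}ᶜ : Set Bool)).preimage hφ)
  -- A common point of these nested sets is a world of the union with the wrong value at `φ`.
  obtain ⟨W, hW⟩ := IsCompact.nonempty_iInter_of_sequence_nonempty_isCompact_isClosed
    (fun n => PC (D n : Set L.Sentence) ∩ {W | W φ ≠ b})
    (fun n => Set.inter_subset_inter_left _ (hanti _ _ n.le_succ))
    (fun n => by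
      obtain ⟨m, hm, W, hW, hne⟩ := hcon n
      exact ⟨W, hanti _ _ hm hW, hne⟩)
    (hcl 0).isCompact hcl
  rw [Set.mem_iInter] at hW
  refine (hW 0).2 (h W ⟨(hW 0).1.1, fun ψ hψ => ?_⟩)
  obtain ⟨n, hn⟩ := Set.mem_iUnion.1 hψ
  exact (hW n).1.2 ψ hn

/-- If there were no world, compactness would give a finite part of `Γ` without one; then `⊥`
follows from it by a tautology and modus ponens. -/
theorem Consistent.nonempty_PC (hΓ : Consistent Γ) : (PC Γ).Nonempty := by
  by_contra hcon
  have hempty : (PC (∅ : Set L.Sentence)) ∩ ⋂ φ : Γ, {W : World L | W φ = true} = ∅ := by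
    rw [Set.eq_empty_iff_forall_notMem]
    rintro W ⟨hW, h⟩
    exact hcon ⟨W, hW.1, fun φ hφ => Set.mem_iInter.1 h ⟨φ, hφ⟩⟩
  obtain ⟨t, ht⟩ := (isClosed_PC (∅ : Set L.Sentence)).isCompact.elim_finite_subfamily_closed
    (fun φ : Γ => {W : World L | W φ = true})
    (fun φ => isClosed_eq (continuous_apply _) continuous_const) hempty
  -- Premises are moved one at a time into an implication, until a tautology is left.
  have key : ∀ l : List Γ, ∀ ψ : L.Sentence, (∀ W : World L, PropConsistent W →
      (∀ φ ∈ l, W φ = true) → W ψ = true) → Proves Γ ψ := by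
    intro l
    induction l with
    | nil => exact fun ψ h => .taut fun W hW => h W hW (by simp)
    | cons φ l ih =>
      refine fun ψ h => .mp (ih (φ.1.imp ψ) fun W hW hl => ?_) (.ax φ.2)
      rw [hW.imp]
      by_cases hφ : W φ = true
      · rw [h W hW (by simpa [hφ] using hl)]; simp
      · simp [hφ]
  refine hΓ (key t.toList ⊥ fun W hW hl => ?_)
  have : W ∈ (∅ : Set (World L)) := by
    rw [← ht]
    exact ⟨⟨hW, by simp⟩, by simpa using hl⟩
  exact this.elim

end Worlds

/-! ### The price of a sentence that describes its own price -/

section Representing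

variable {L : FirstOrder.Language.{0, 0}} {Γ : Set L.Sentence}

theorem realize_univClosure {M : Type} [L.Structure M] {k : ℕ} (φ : L.Formula (Fin k)) :
    M ⊨ univClosure φ ↔ ∀ x : Fin k → M, φ.Realize x := by
  rw [univClosure, Sentence.Realize, BoundedFormula.realize_alls]
  exact forall_congr' fun x => Formula.realize_relabel_sumInr φ

/-- Worlds treat quantified sentences as atoms, so first-order reasoning must pass through `Γ`: the
nested implication from `l` to `ψ` is valid, hence provable, hence true in `W`. This allows arguing
inside models. -/
theorem world_of_models (hΓ : IncludesFirstOrderLogic Γ) {W : World L} (hW : W ∈ PC Γ)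
    {l : List L.Sentence} (hl : ∀ φ ∈ l, Proves Γ φ) {ψ : L.Sentence}
    (h : ∀ (M : Type) [L.Structure M] [Nonempty M], (∀ φ ∈ l, M ⊨ φ) → M ⊨ ψ) : W ψ = true := by
  have key : ∀ l : List L.Sentence, (∀ φ ∈ l, Proves Γ φ) → ∀ ψ : L.Sentence,
      (∀ (M : Type) [L.Structure M] [Nonempty M], (∀ φ ∈ l, M ⊨ φ) → M ⊨ ψ) → W ψ = true := by
    intro l
    induction l with
    | nil =>
      intro _ ψ h
      refine (hΓ ψ fun M v xs => ?_).sound hW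
      have hM := h M (by simp)
      rwa [Sentence.Realize, Formula.Realize, Subsingleton.elim default v,
        Subsingleton.elim default xs] at hM
    | cons φ l ih =>
      intro hl ψ h
      have h₁ := ih (fun χ hχ => hl χ (by simp [hχ])) (φ.imp ψ) fun M _ _ hM => by
        refine BoundedFormula.realize_imp.2 fun hφ => h M fun χ hχ => ?_
        rcases List.mem_cons.1 hχ with rfl | hχ
        exacts [hφ, hM χ hχ]
      rw [hW.1.imp, (hl φ (by simp)).sound hW] at h₁
      simpa using h₁
  exact key l hl ψ h

variable {num : ℕ → L.Formula (Fin 1)} {γ lt : L.Formula (Fin 2)} {f : ℕ → ℕ}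

/-- In a model, anything satisfying `γ` at `m` satisfies the numeral formula of the actual value
`x`, so the provable `x < p` applies to it. -/
theorem valueLtSentence_of_lt (hΓ : IncludesFirstOrderLogic Γ) (hγ : Represents Γ num γ f)
    (hlt : RepresentsRatLt Γ num lt) {m : ℕ} {x p : ℚ} (hm : f m = ratCode x) (hxp : x < p)
    {W : World L} (hW : W ∈ PC Γ) : W (valueLtSentence num γ lt m p) = true := by
  refine world_of_models hΓ hW (l := [_, _])
    (by simpa using ⟨(hγ m (f m)).1 rfl, (hlt x p).1 hxp⟩) fun M _ _ hM => ?_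
  simp only [List.mem_cons, List.not_mem_nil, or_false, forall_eq_or_imp, forall_eq,
    valueSentence, valueLtSentence, realize_univClosure, Formula.realize_imp, Formula.realize_iff,
    Formula.realize_relabel, hm] at hM ⊢
  intro y h₀ h₁ h₂
  have h₃ : y ∘ ![0, 2] ∘ ![0] = y ∘ ![0] := by funext i; fin_cases i; rfl
  have h₄ : y ∘ ![2, 1] ∘ ![0] = y ∘ ![0, 2] ∘ ![1] := by funext i; fin_cases i; rfl
  have h₅ : y ∘ ![2, 1] ∘ ![1] = y ∘ ![1] := by funext i; fin_cases i; rfl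
  refine hM.2 (y ∘ ![2, 1]) ?_ ?_
  · rw [Function.comp_assoc, h₄]
    exact (hM.1 (y ∘ ![0, 2]) (by rwa [Function.comp_assoc, h₃])).1 h₂
  · rwa [Function.comp_assoc, h₅]

/-- The universal sentence needs a counterexample in each model, so the numeral formulas of `m`, `x`
and `p` have to be satisfiable there. -/
theorem not_valueLtSentence_of_le (hΓ : IncludesFirstOrderLogic Γ) (hnum : AreNumerals Γ num)
    (hγ : Represents Γ num γ f) (hlt : RepresentsRatLt Γ num lt) {m : ℕ} {x p : ℚ}
    (hm : f m = ratCode x) (hxp : p ≤ x) {W : World L} (hW : W ∈ PC Γ) :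
    W (valueLtSentence num γ lt m p) = false := by
  suffices h : W (BoundedFormula.not (valueLtSentence num γ lt m p)) = true by
    rw [hW.1.not] at h
    simpa using h
  refine world_of_models hΓ hW (l := [_, _, _, _, _])
    (by simpa using ⟨(hγ m (f m)).1 rfl, (hlt x p).2 hxp.not_gt, (hnum m).1,
      (hnum (ratCode x)).1, (hnum (ratCode p)).1⟩) fun M _ _ hM => ?_
  simp only [List.mem_cons, List.not_mem_nil, or_false, forall_eq_or_imp, forall_eq,
    valueSentence, valueLtSentence, realize_univClosure, Formula.realize_imp, Formula.realize_iff,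
    Formula.realize_relabel, hm, Sentence.realize_not, Formula.realize_not] at hM ⊢
  obtain ⟨hval, hlt, h₀, h₁, h₂⟩ := hM
  push Not at h₀ h₁ h₂ ⊢
  obtain ⟨a, ha⟩ := h₀
  obtain ⟨b, hb⟩ := h₁
  obtain ⟨c, hc⟩ := h₂
  have e₀ : ![a 0, b 0] ∘ ![0] = a := by funext i; fin_cases i; rfl
  have e₁ : ![a 0, b 0] ∘ ![1] = b := by funext i; fin_cases i; rfl
  have e₂ : ![b 0, c 0] ∘ ![0] = b := by funext i; fin_cases i; rfl
  have e₃ : ![b 0, c 0] ∘ ![1] = c := by funext i; fin_cases i; rfl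
  have e₄ : ![a 0, c 0, b 0] ∘ ![0] = a := by funext i; fin_cases i; rfl
  have e₅ : ![a 0, c 0, b 0] ∘ ![1] = c := by funext i; fin_cases i; rfl
  have e₆ : ![a 0, c 0, b 0] ∘ ![0, 2] = ![a 0, b 0] := by funext i; fin_cases i <;> rfl
  have e₇ : ![a 0, c 0, b 0] ∘ ![2, 1] = ![b 0, c 0] := by funext i; fin_cases i <;> rfl
  refine ⟨![a 0, c 0, b 0], by rwa [e₄], by rwa [e₅], ?_, ?_⟩
  · rw [e₆]
    exact (hval _ (by rwa [e₀])).2 (by rwa [e₁])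
  · rw [e₇]
    exact hlt _ (by rwa [e₂]) (by rwa [e₃])

end Representing

end LogicalInduction

/-! ### The limit of the self-referential price -/

open FirstOrder LogicalInduction
theorem mainTheorem11 {L : FirstOrder.Language.{0, 0}}
    [∀ n, Encodable (L.Functions n)] [∀ n, Encodable (L.Relations n)]
    (Γ : Set L.Sentence) (hfol : IncludesFirstOrderLogic Γ) (hcons : Consistent Γ)
    -- `Γ` can represent computable functions, `γ f` being the formula for `f`
    (num : ℕ → L.Formula (Fin 1)) (hnum : AreNumerals Γ num)
    (γ : (ℕ → ℕ) → L.Formula (Fin 2)) (hγ : ∀ f, Computable f → Represents Γ num (γ f) f)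
    (lt : L.Formula (Fin 2)) (hlt : RepresentsRatLt Γ num lt)
    -- a logical inductor over `Γ`, and a program for its prices
    (P : ℕ → L.Sentence → ℚ) (hP : IsLogicalInductor Γ P)
    (f : ℕ → ℕ) (hf : ComputesPrices f P)
    (p : ℚ) (hp : p ∈ Set.Ioo (0 : ℚ) 1)
    (χ : ℕ → L.Sentence) (hχ : EfficientlyComputable sentenceString χ)
    (hpar : ∀ n, Proves Γ
      ((χ n).iff (valueLtSentence num (γ f) lt (Nat.pair n (code (χ n))) p))) :
    Filter.Tendsto (fun n => (P n (χ n) : ℝ)) Filter.atTop (nhds (p : ℝ)) := by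
  obtain ⟨⟨hP01, -⟩, D, ⟨hDmono, -⟩, hcomp, hlic⟩ := hP
  have hD : ∀ n, (PC (D n : Set L.Sentence)).Nonempty := fun n => by
    obtain ⟨W, hW⟩ := hcons.nonempty_PC
    rw [← hcomp] at hW
    exact ⟨W, hW.1, fun φ hφ => hW.2 φ (Set.mem_iUnion.2 ⟨n, hφ⟩)⟩
  have htruth : ∀ n, ∀ W ∈ PC Γ, W (χ n) = decide (P n (χ n) < p) := fun n W hW => by
    have h₁ := (hpar n).sound hW
    rw [hW.1.iff, beq_iff_eq] at h₁
    rw [h₁]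
    by_cases h : P n (χ n) < p
    · simpa [h] using valueLtSentence_of_lt hfol (hγ f hf.1) hlt (hf.2 n (χ n)) h hW
    · simpa [h] using
        not_valueLtSentence_of_le hfol hnum (hγ f hf.1) hlt (hf.2 n (χ n)) (not_lt.1 h) hW
  have hsettled : ∀ n, ∃ N, ∀ m ≥ N, ∀ W ∈ PC (D m : Set L.Sentence),
      W (χ n) = decide (P n (χ n) < p) := fun n =>
    exists_PC_settled hDmono (hcomp ▸ htruth n)
  rw [tendsto_order]
  constructor
  · intro a ha
    obtain ⟨q, haq, hqp⟩ := exists_rat_btwn ha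
    -- Lower bound: one share of `χ n`, which turns out true whenever it was cheaper than `p`.
    have h := eventually_le_price_of_recycling (π := ⟨0, 1, p, q⟩) hP01 hD hlic hχ
      (.inl ⟨rfl, rfl⟩) hp (by exact_mod_cast hqp) (fun i hi => ?_) (half_pos (sub_pos.2 haq))
    · filter_upwards [h] with n hn
      push_cast at hn
      linarith
    · obtain ⟨N, hN⟩ := hsettled i
      have hi : P i (χ i) < p := by
        push_cast at hi
        rw [zero_add, one_mul] at hi
        exact_mod_cast hi
      exact ⟨N, fun m hm W hW => by simp [hN m hm W hW, hi]⟩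
  · intro a ha
    obtain ⟨q, haq, hqp⟩ := exists_rat_btwn (show 1 - a < 1 - (p : ℝ) by linarith)
    -- Upper bound: a short share with one unit of cash costs less than `1 - p` exactly when `χ n`
    -- costs more than `p`; then `χ n` is false and the position is worth one.
    have h := eventually_le_price_of_recycling (π := ⟨1, -1, 1 - p, q⟩) hP01 hD hlic hχ
      (.inr ⟨rfl, rfl⟩) ⟨by linarith [hp.2], by linarith [hp.1]⟩ (by exact_mod_cast hqp)
      (fun i hi => ?_) (half_pos (sub_pos.2 haq))
    · filter_upwards [h] with n hn
      push_cast at hn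
      linarith
    · obtain ⟨N, hN⟩ := hsettled i
      have hi : ¬ P i (χ i) < p := by
        push_cast at hi
        have : (p : ℝ) < P i (χ i) := by linarith
        exact not_lt.2 (by exact_mod_cast this.le)
      exact ⟨N, fun m hm W hW => by simp [hN m hm W hW, hi]⟩
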